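/- Setting. Let $M$ be a complex manifold with holomorphic tangent bundle $TM$ (identified with $T^{1,0}M$). A CV-structure on a holomorphic vector bundle $K\to M$ (of finite rank) is a tuple $(K,C,\mathcal U,g,\kappa,h,D,\mathcal Q)$ such that * $C$ is a holomorphic $\mathrm{End}(K)$-valued $1$-form, $\mathcal U$ is a holomorphic endomorphism of $K$ and $g$ is a holomorphic symmetric non-degenerate bilinear form on $K$, with $C_XC_Y=C_YC_X$, $[C_X,\mathcal U]=0$, $g(C_Xa,b)=g(a,C_Xb)$ and $g(\mathcal Ua,b)=g(a,\mathcal Ub)$; * $\kappa:K\to K$ is a smooth fibrewise $\mathbb C$-antilinear automorphism with $\kappa^2=\mathrm{id}$ and $g(\kappa a,\kappa b)=\overline{g(a,b)}$; * $h=g(\cdot,\kappa\,\cdot)$, a non-degenerate hermitian form, and its Chern connection $D$ satisfies $D\kappa=0$, $D_X(C_Y)-D_Y(C_X)-C_{[X,Y]}=0$ for holomorphic vector fields $X,Y$, and $R^D(X,\bar Y)+[C_X,\kappa C_Y\kappa]=0$; * $\mathcal Q$ is a smooth endomorphism of $K$ with $g(\mathcal Qa,b)=-g(a,\mathcal Qb)$,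 $h(\mathcal Qa,b)=h(a,\mathcal Qb)$, $D_X(\mathcal U)-[C_X,\mathcal Q]+C_X=0$ and $D_X(\mathcal Q)+[C_X,\kappa\,\mathcal U\kappa]=0$ for $X\in TM$. It is a CV$\oplus$-structure if $h$ is positive definite. It satisfies the unfolding condition if there is a global holomorphic section $\zeta$ of $K$ such that $I:TM\to K$, $I(X)=-C_X\zeta$, is an isomorphism. In that case $C_{X\circ Y}\zeta=-C_XC_Y\zeta$ and $C_e\zeta=-\zeta$ define a commutative associative multiplication $\circ$ on $TM$ with unit field $e$. Let $h^{end}$ be the hermitian form on $\mathrm{End}(K)$ given by $h^{end}(A,B)=\sum_i h(Ae_i,Be_i^*)$, where $(e_i)$ is a basis of the fibre of $K$ and $h(e_i,e_j^*)=\delta_{ij}$; let $h^F$ be its restriction to $F=\{C_X\mid X\in TM\}\subset\mathrm{End}(K)$, and let $h^M$ be the hermitian form on $TM$ that corresponds to $h^F$ under $X\mapsto -C_X$. When $h^M$ is non-degenerate, $R^M$ denotes the curvature of its Chern connection, and for $X\in TM$ with $h^M(X,X)\neq 0$ $$R^{sect}(X)=\frac{h^M(R^M(X,\bar X)X,X)}{h^M(X,X)^2}.$$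 Theorem. Let $(K\to M,C,\mathcal U,g,\kappa,h,D,\mathcal Q)$ be a CV$\oplus$-structure with the unfolding condition. Then the hermitian forms $h^{end}$, $h^F$ and $h^M$ are positive definite. Moreover: (a) $R^{sect}(X)\le 0$ for all $X\in TM\setminus\{0\}$, and $R^{sect}(e)=0$. (b) Let $t\in M$ be such that $(T_tM,\circ_t,e_t)$ is an irreducible algebra (non-zero, and not the direct sum of two non-zero ideals). Then $T_tM$ has a unique maximal ideal $I^{max}(T_tM)$, and $T_tM=\mathbb Ce_t\oplus I^{max}(T_tM)$. There are an open neighbourhood $V$ of $t$ and subsets $U_{x}\subset T_{x}M$, $x\in V$, such that for every $x\in V$ $$T_{x}M=\mathbb Ce_{x}+U_{x},\qquad \mathbb Ce_{x}\cap U_{x}=\{0\},$$ and: (i) for every $x\in V$, $U_{x}$ is a cone, i.e. $r\,U_{x}\subset U_{x}$ for all real $r\ge 0$, and $I^{max}(T_tM)\subset U_t$; (ii) there is $k_0>0$ such that $R^{sect}(X)<-k_0$ for all $x\in V$ and $X\in U_{x}\setminus\{0\}$; (iii) for every $\lambda_0>0$ there is $k_1>0$ such that $R^{sect}(X)<-k_1$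 for all $x\in V$ and all $X\in T_{x}M$ with $X-e_{x}\in U_{x}\setminus\{0\}$ and $h^M(X-e_{x},X-e_{x})>\lambda_0\,h^M(X,X)$. -/

import Mathlib

open Bundle Manifold
open scoped Manifold ContDiff ComplexOrder Topology ComplexConjugate

noncomputable section

namespace TTStar

/-! ### Linear algebra of hermitian forms -/

section LinearAlgebra

variable {W : Type*} [AddCommGroup W] [Module ℂ W]

/-- A positive definite hermitian form: complex linear in the first argument, conjugate symmetric
(hence conjugate linear in the second argument), and `h a a` is real and positive for `a ≠ 0`. -/
structure IsPosDefHermitian (h : W → W → ℂ) : Prop where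
  add_left : ∀ a a' b, h (a + a') b = h a b + h a' b
  smul_left : ∀ (c : ℂ) a b, h (c • a) b = c * h a b
  conj_symm : ∀ a b, h b a = conj (h a b)
  pos : ∀ a, a ≠ 0 → 0 < h a a

/-- The family `e*` which is `h`-dual to `e`: `h (e i) (e* j) = δ i j`. It exists and is unique
when `h` is a non-degenerate hermitian form and `e` is a basis of a finite dimensional space. -/
def dualFamily {ι : Type*} [DecidableEq ι] (h : W → W → ℂ) (e : ι → W) : ι → W :=
  Classical.epsilon fun d : ι → W => ∀ i j, h (e i) (d j) = if i = j then 1 else 0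

/-- The form on `End W` induced by a non-degenerate hermitian form `h` on `W`,
`h^end (A, B) = ∑ i, h (A (e i)) (B (e* i))`, computed with the basis `e` and the `h`-dual
basis `e*`; it does not depend on the basis. -/
def endForm {ι : Type*} [Fintype ι] [DecidableEq ι] (h : W → W → ℂ) (e : Module.Basis ι ℂ W)
    (A B : Module.End ℂ W) : ℂ :=
  ∑ i, h (A (e i)) (B (dualFamily h e i))

/-- Ideals of a (commutative) algebra with multiplication `mul`. -/
def IsIdealOf (mul : W → W → W) (N : Submodule ℂ W) : Prop :=
  ∀ a, ∀ b ∈ N, mul a b ∈ N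

/-- Maximal ideals of a commutative algebra with multiplication `mul`. -/
structure IsMaximalIdealOf (mul : W → W → W) (N : Submodule ℂ W) : Prop where
  isIdeal : IsIdealOf mul N
  ne_top : N ≠ ⊤
  eq_of_le : ∀ N' : Submodule ℂ W, IsIdealOf mul N' → N ≤ N' → N' ≠ ⊤ → N' = N

/-- An irreducible algebra: it is non-zero and is not the direct sum of two non-zero ideals. -/
structure IsIrreducibleAlgebra (mul : W → W → W) : Prop where
  nontrivial : Nontrivial W
  indecomposable : ∀ N N' : Submodule ℂ W, IsIdealOf mul N → IsIdealOf mul N' → IsCompl N N' →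
    N = ⊥ ∨ N' = ⊥

end LinearAlgebra

/-! ### Calculus on complex manifolds

A complex manifold is a charted space `M` over the finite dimensional complex vector space `E`
with `IsManifold 𝓘(ℂ, E) ω M`; the holomorphic tangent space at `t` is `TangentSpace 𝓘(ℂ, E) t`.
A tangent vector `X` acts on smooth functions both through the vector field of type `(1,0)` that it
determines (`del`) and through its conjugate of type `(0,1)` (`delBar`). -/

section Calculus

variable {E : Type*} [NormedAddCommGroup E] [NormedSpace ℂ E]
  {M : Type*} [TopologicalSpace M] [ChartedSpace E M]

/-- The real differential of a (vector valued) function on `M`. -/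
def realDeriv {G : Type*} [NormedAddCommGroup G] [NormedSpace ℂ G] (f : M → G) (t : M)
    (X : TangentSpace 𝓘(ℂ, E) t) : G :=
  (mfderiv 𝓘(ℝ, E) 𝓘(ℝ, G) f t : E →L[ℝ] G) X

/-- The `(1,0)`-derivative `∂_X f = (df(X) - i df(iX)) / 2`. -/
def del {G : Type*} [NormedAddCommGroup G] [NormedSpace ℂ G] (f : M → G) (t : M)
    (X : TangentSpace 𝓘(ℂ, E) t) : G :=
  (1 / 2 : ℂ) • (realDeriv f t X - Complex.I • realDeriv f t (Complex.I • X))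

/-- The `(0,1)`-derivative `∂_X̄ f = (df(X) + i df(iX)) / 2`. -/
def delBar {G : Type*} [NormedAddCommGroup G] [NormedSpace ℂ G] (f : M → G) (t : M)
    (X : TangentSpace 𝓘(ℂ, E) t) : G :=
  (1 / 2 : ℂ) • (realDeriv f t X + Complex.I • realDeriv f t (Complex.I • X))

variable (F : Type*) [NormedAddCommGroup F] [NormedSpace ℂ F]
  {V : M → Type*} [TopologicalSpace (TotalSpace F V)]
  [∀ x, AddCommGroup (V x)] [∀ x, Module ℂ (V x)] [∀ x, TopologicalSpace (V x)]
  [FiberBundle F V]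

/-- A section of a holomorphic vector bundle is holomorphic at `t` (that is, near `t`). -/
def IsHolAt (s : ∀ x, V x) (t : M) : Prop :=
  ContMDiffAt 𝓘(ℂ, E) (𝓘(ℂ, E).prod 𝓘(ℂ, F)) ω (fun x => TotalSpace.mk' F x (s x)) t

/-- A section of a holomorphic vector bundle is `C^∞` (in the real sense) at `t`. -/
def IsSmoothAt (s : ∀ x, V x) (t : M) : Prop :=
  ContMDiffAt 𝓘(ℝ, E) (𝓘(ℝ, E).prod 𝓘(ℝ, F)) ∞ (fun x => TotalSpace.mk' F x (s x)) t

/-- The Cauchy-Riemann operator `∂_X̄ s` on sections of a holomorphic vector bundle, computed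
in a holomorphic trivialization. -/
def dbar (s : ∀ x, V x) (t : M) (X : TangentSpace 𝓘(ℂ, E) t) : V t :=
  (trivializationAt F V t).symm t
    (delBar (fun x => (trivializationAt F V t ⟨x, s x⟩).2) t X)

/-- The `(1,0)`-part of the Chern connection `D` of a hermitian metric `h` on a holomorphic vector
bundle (its `(0,1)`-part is `dbar`): `D_X s` is the vector determined by
`∂_X (h (s, s')) = h (D_X s, s')` for all local holomorphic sections `s'`. -/
def chernD (h : ∀ x, V x → V x → ℂ) (s : ∀ x, V x) (t : M)
    (X : TangentSpace 𝓘(ℂ, E) t) : V t :=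
  Classical.epsilon fun w : V t => ∀ s' : ∀ x, V x, IsHolAt (E := E) F s' t →
    h t w (s' t) = del (fun x => h x (s x) (s' x)) t X

/-- The extension of a vector in a fibre to a local holomorphic section which is constant in the
preferred trivialization. -/
def localExt {t : M} (v : V t) : ∀ x, V x :=
  fun x => (trivializationAt F V t).symm x (trivializationAt F V t ⟨t, v⟩).2

/-- The `(1,1)`-part `R(X, Ȳ)` of the curvature of the Chern connection of `h`, as the commutator
`D_X D_Ȳ - D_Ȳ D_X` evaluated at `t`, where `X`, `Y` and the section are
extended to be constant in the preferred chart and trivialization. These extensions are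
holomorphic, so that `[X, Ȳ] = 0`, and the result depends only on the vectors at `t`. -/
def chernCurvature [IsManifold 𝓘(ℂ, E) ω M] (h : ∀ x, V x → V x → ℂ) {t : M}
    (X Y : TangentSpace 𝓘(ℂ, E) t) (v : V t) : V t :=
  chernD F h (fun x => dbar F (localExt F v) x (localExt E Y x)) t X
    - dbar F (fun x => chernD F h (localExt F v) x (localExt E X x)) t Y

end Calculus

/-! ### CV-structures -/

section CV

variable (E : Type*) [NormedAddCommGroup E] [NormedSpace ℂ E]
  {M : Type*} [TopologicalSpace M] [ChartedSpace E M] [IsManifold 𝓘(ℂ, E) ω M]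
  (F : Type*) [NormedAddCommGroup F] [NormedSpace ℂ F]
  (K : M → Type*) [TopologicalSpace (TotalSpace F K)]
  [∀ x, AddCommGroup (K x)] [∀ x, Module ℂ (K x)] [∀ x, TopologicalSpace (K x)]
  [FiberBundle F K]

/-- A CV-structure `(C, U, g, κ, h, D, Q)` on the holomorphic vector bundle `K → M`. The connection
`D` is the Chern connection of `h`, so its `(1,0)`-part is `chernD F h` and its `(0,1)`-part is
`dbar F`. -/
structure CVStructure where
  /-- the Higgs field -/
  C : ∀ t : M, TangentSpace 𝓘(ℂ, E) t →ₗ[ℂ] Module.End ℂ (K t)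
  /-- the holomorphic endomorphism -/
  U : ∀ t : M, Module.End ℂ (K t)
  /-- the holomorphic bilinear form -/
  g : ∀ t : M, LinearMap.BilinForm ℂ (K t)
  /-- the real structure -/
  κ : ∀ t : M, K t →ₛₗ[starRingEnd ℂ] K t
  /-- the hermitian metric -/
  h : ∀ t : M, K t → K t → ℂ
  /-- the smooth endomorphism -/
  Q : ∀ t : M, Module.End ℂ (K t)
  C_hol : ∀ (t : M) (X : ∀ x : M, TangentSpace 𝓘(ℂ, E) x) (s : ∀ x, K x),
    IsHolAt (E := E) E X t → IsHolAt (E := E) F s t →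
      IsHolAt (E := E) F (fun x => C x (X x) (s x)) t
  U_hol : ∀ (t : M) (s : ∀ x, K x), IsHolAt (E := E) F s t →
    IsHolAt (E := E) F (fun x => U x (s x)) t
  g_hol : ∀ (t : M) (s s' : ∀ x, K x), IsHolAt (E := E) F s t → IsHolAt (E := E) F s' t →
    ContMDiffAt 𝓘(ℂ, E) 𝓘(ℂ, ℂ) ω (fun x => g x (s x) (s' x)) t
  κ_smooth : ∀ (t : M) (s : ∀ x, K x), IsSmoothAt (E := E) F s t →
    IsSmoothAt (E := E) F (fun x => κ x (s x)) t
  Q_smooth : ∀ (t : M) (s : ∀ x, K x), IsSmoothAt (E := E) F s t →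
    IsSmoothAt (E := E) F (fun x => Q x (s x)) t
  /-- `C ∧ C = 0` -/
  C_comm : ∀ t X Y a, C t X (C t Y a) = C t Y (C t X a)
  /-- `[C, U] = 0` -/
  C_comm_U : ∀ t X a, C t X (U t a) = U t (C t X a)
  g_symm : ∀ t a b, g t a b = g t b a
  g_nondeg : ∀ t, (g t).Nondegenerate
  g_C : ∀ t X a b, g t (C t X a) b = g t a (C t X b)
  g_U : ∀ t a b, g t (U t a) b = g t a (U t b)
  κ_invol : ∀ t a, κ t (κ t a) = a
  g_κ : ∀ t a b, g t (κ t a) (κ t b) = conj (g t a b)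
  /-- `h = g (·, κ ·)`; with the preceding conditions `h` is hermitian and non-degenerate -/
  h_eq : ∀ t a b, h t a b = g t a (κ t b)
  /-- `D κ = 0`: as `κ` is antilinear, it exchanges the `(1,0)`- and the `(0,1)`-part of `D`. -/
  D_κ : ∀ (t : M) (X : TangentSpace 𝓘(ℂ, E) t) (s : ∀ x, K x), IsSmoothAt (E := E) F s t →
    chernD F h (fun x => κ x (s x)) t X = κ t (dbar F s t X) ∧
    dbar F (fun x => κ x (s x)) t X = κ t (chernD F h s t X)
  /-- `D^(1,0) C = 0`: `D_X (C_Y) - D_Y (C_X) - C_[X,Y] = 0` for holomorphic vector fields. -/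
  D_C : ∀ (t : M) (X Y : ∀ x : M, TangentSpace 𝓘(ℂ, E) x) (s : ∀ x, K x),
    IsHolAt (E := E) E X t → IsHolAt (E := E) E Y t → IsSmoothAt (E := E) F s t →
    (chernD F h (fun x => C x (Y x) (s x)) t (X t) - C t (Y t) (chernD F h s t (X t)))
      - (chernD F h (fun x => C x (X x) (s x)) t (Y t) - C t (X t) (chernD F h s t (Y t)))
      - C t (VectorField.mlieBracket 𝓘(ℂ, E) X Y t) (s t) = 0
  /-- the `tt*`-equation `R(X, Ȳ) + [C_X, κ C_Y κ] = 0` -/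
  tt_star : ∀ (t : M) (X Y : TangentSpace 𝓘(ℂ, E) t) (a : K t),
    chernCurvature F h X Y a
      + (C t X (κ t (C t Y (κ t a))) - κ t (C t Y (κ t (C t X a)))) = 0
  g_Q : ∀ t a b, g t (Q t a) b = - g t a (Q t b)
  /-- `D^(1,0) U - [C, Q] + C = 0` -/
  D_U : ∀ (t : M) (X : TangentSpace 𝓘(ℂ, E) t) (s : ∀ x, K x), IsSmoothAt (E := E) F s t →
    (chernD F h (fun x => U x (s x)) t X - U t (chernD F h s t X))
      - (C t X (Q t (s t)) - Q t (C t X (s t))) + C t X (s t) = 0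
  /-- `D^(1,0) Q + [C, κ U κ] = 0` -/
  D_Q : ∀ (t : M) (X : TangentSpace 𝓘(ℂ, E) t) (s : ∀ x, K x), IsSmoothAt (E := E) F s t →
    (chernD F h (fun x => Q x (s x)) t X - Q t (chernD F h s t X))
      + (C t X (κ t (U t (κ t (s t)))) - κ t (U t (κ t (C t X (s t))))) = 0
  h_Q : ∀ t a b, h t (Q t a) b = h t a (Q t b)

namespace CVStructure

variable {E F K} (S : CVStructure E F K)

/-- A CV⊕-structure: `h` is positive definite. -/
def IsPositive : Prop := ∀ t, IsPosDefHermitian (S.h t)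

/-- A primitive section: a global holomorphic section `ζ` of `K` such that
`X ↦ - C_X ζ` is an isomorphism from `TM` to `K`. The unfolding condition is the existence of a
primitive section. -/
structure IsPrimitive (ζ : ∀ x, K x) : Prop where
  hol : ∀ t, IsHolAt (E := E) F ζ t
  bij : ∀ t, Function.Bijective fun X : TangentSpace 𝓘(ℂ, E) t => - S.C t X (ζ t)

section Unfolding

variable {S} {ζ : ∀ x, K x} (hζ : S.IsPrimitive ζ)

/-- The isomorphism `I = - C_• ζ` from `T_t M` to `K_t`. -/
def IsPrimitive.iso (t : M) : TangentSpace 𝓘(ℂ, E) t ≃ₗ[ℂ] K t :=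
  LinearEquiv.ofBijective (-((S.C t).flip (ζ t))) (hζ.bij t)

/-- The multiplication on `T_t M`, determined by `C_(X ∘ Y) ζ = - C_X C_Y ζ`. -/
def IsPrimitive.mul (t : M) (X Y : TangentSpace 𝓘(ℂ, E) t) : TangentSpace 𝓘(ℂ, E) t :=
  (hζ.iso t).symm (S.C t X (S.C t Y (ζ t)))

/-- The unit field, determined by `C_e ζ = - ζ`. -/
def IsPrimitive.unit (t : M) : TangentSpace 𝓘(ℂ, E) t :=
  (hζ.iso t).symm (ζ t)

end Unfolding

/-- The subbundle `{C_X | X ∈ TM}` of `End K`. -/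
def imageC (t : M) : Submodule ℂ (Module.End ℂ (K t)) := LinearMap.range (S.C t)

variable [FiniteDimensional ℂ F] [VectorBundle ℂ F K]

/-- The basis of the fibre `K_t` given by the preferred trivialization. -/
def fiberBasis (F : Type*) [NormedAddCommGroup F] [NormedSpace ℂ F]
    {K : M → Type*} [TopologicalSpace (TotalSpace F K)]
    [∀ x, AddCommGroup (K x)] [∀ x, Module ℂ (K x)] [∀ x, TopologicalSpace (K x)]
    [FiberBundle F K] [FiniteDimensional ℂ F] [VectorBundle ℂ F K] (t : M) :
    Module.Basis (Fin (Module.finrank ℂ F)) ℂ (K t) :=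
  (Module.finBasis ℂ F).map
    ((trivializationAt F K t).linearEquivAt ℂ t (FiberBundle.mem_baseSet_trivializationAt' t)).symm

/-- The hermitian form `h^end` on `End K`. -/
def hEnd (t : M) (A B : Module.End ℂ (K t)) : ℂ := endForm (S.h t) (fiberBasis F t) A B

/-- The restriction `h^F` of `h^end` to the subbundle `{C_X | X ∈ TM}`. -/
def hF (t : M) (A B : S.imageC t) : ℂ := S.hEnd t A B

/-- The CV-metric `h^M` on `TM`, obtained from `h^F` through the isomorphism `X ↦ - C_X`. -/
def hM (t : M) (X Y : TangentSpace 𝓘(ℂ, E) t) : ℂ :=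
  S.hF t (-(S.C t).rangeRestrict X) (-(S.C t).rangeRestrict Y)

/-- The holomorphic sectional curvature
`R^sect (X) = h^M (R^M (X, X̄) X, X) / h^M (X, X)^2` of the CV-metric. -/
def sectionalCurvature {t : M} (X : TangentSpace 𝓘(ℂ, E) t) : ℂ :=
  S.hM t (chernCurvature E S.hM X X X) X / (S.hM t X X) ^ 2

end CVStructure

end CV

end TTStar

end

/-!
# The sectional curvature of the CV-metric

Write `A*` for the adjoint of an endomorphism `A` with respect to `h`, and `‖A‖² = h^end(A, A)`,
which is `tr (A A*)` and hence positive definite (`IsPosDefHermitian.endForm`). The adjoint of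
`C_X` is `κ C_X κ`, because `h = g(·, κ ·)` and `C_X` is symmetric for `g` (`CVStructure.h_C`).

Part (a) rests on one formula. Under `X ↦ -C_X` the bundle `TM` becomes a holomorphic subbundle of
`End K`, and `h^M` is the metric induced by `h^end`. The Gauss equation for this subbundle and the
`tt*`-equation `R(X, X̄) = -[C_X, C_X*]` give (`CVStructure.hM_chernCurvature`)

  `h^M(R^M(X, X̄) X, X) = -‖[C_X, C_X*]‖² - ‖D_X (C_X) - C_{D^M_X X}‖²`,

where `D^M` is the Chern connection of `h^M`, whose curvature thus is non-positive. It is obtained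
here from the second derivative of `y ↦ tr (A H⁻¹ Aᴴ H)`, where `H` is the Gram matrix of `h` and
`A` the holomorphic matrix of `C_X` in a holomorphic frame, for a vector field `X` which is
constant in a chart (`IsMetricNear.wirtingerBar_wirtinger_trace`). For the unit field, `C_e = -1`,
so the commutator vanishes. Moreover `D_e (C_e)` commutes with all `C_Z`, so that it is itself of
the form `C_W`, as `ζ` is a cyclic vector (`CVStructure.IsPrimitive.exists_eq_C`). Hence the second
term vanishes as well.

For part (b), Fitting's lemma shows that every element of the irreducible algebra `T_t M` is a
multiple of the unit plus a nilpotent element (`IsFaithfulRep.exists_isNilpotent_sub`). Therefore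
the maximal ideal consists of the nilpotent elements. A nilpotent endomorphism that commutes with
its adjoint is zero (`IsPosDefHermitian.eq_zero_of_isNilpotent_of_commute`), so `[C_X, C_X*] ≠ 0`
for `X ≠ 0` in the maximal ideal. The cones `U_x` are the subspaces into which a chart carries the
maximal ideal of `T_t M`. By compactness of its unit sphere, `‖[C_X, C_X*]‖²` is bounded below by a
multiple of `h^M(X, X)²` on all `U_x` with `x` near `t` (`CVStructure.exists_uniform_bound`), and
`R^sect` is bounded above by minus the quotient of the two
(`CVStructure.sectionalCurvature_le`). Finally `[C_X, C_X*]` does not change when a multiple of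
`e` is added to `X`. This gives `ℂ e_x ∩ U_x = {0}`, and it reduces the bound for `e + U_x` to the
one for `U_x`.
-/

namespace TTStar

set_option linter.unusedSectionVars false

/-! ### Hermitian linear algebra in a basis -/

section HermitianAlgebra

open Matrix

variable {W : Type*} [AddCommGroup W] [Module ℂ W] {h : W → W → ℂ}

namespace IsPosDefHermitian

theorem zero_left (hh : IsPosDefHermitian h) (b : W) : h 0 b = 0 := by
  simpa using hh.smul_left 0 0 b

theorem add_right (hh : IsPosDefHermitian h) (a b b' : W) : h a (b + b') = h a b + h a b' := by
  rw [hh.conj_symm, hh.add_left, map_add, ← hh.conj_symm, ← hh.conj_symm]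

theorem smul_right (hh : IsPosDefHermitian h) (c : ℂ) (a b : W) :
    h a (c • b) = conj c * h a b := by
  rw [hh.conj_symm, hh.smul_left, map_mul, ← hh.conj_symm]

theorem neg_left (hh : IsPosDefHermitian h) (a b : W) : h (-a) b = -h a b := by
  simpa using hh.smul_left (-1) a b

theorem neg_right (hh : IsPosDefHermitian h) (a b : W) : h a (-b) = -h a b := by
  simpa using hh.smul_right (-1) a b

theorem sub_left (hh : IsPosDefHermitian h) (a a' b : W) : h (a - a') b = h a b - h a' b := by
  rw [sub_eq_add_neg, hh.add_left, hh.neg_left, sub_eq_add_neg]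

theorem sub_right (hh : IsPosDefHermitian h) (a b b' : W) : h a (b - b') = h a b - h a b' := by
  rw [sub_eq_add_neg, hh.add_right, hh.neg_right, sub_eq_add_neg]

theorem sum_left (hh : IsPosDefHermitian h) {ι : Type*} (s : Finset ι) (f : ι → W) (b : W) :
    h (∑ i ∈ s, f i) b = ∑ i ∈ s, h (f i) b :=
  map_sum (AddMonoidHom.mk' (fun a => h a b) fun a a' => hh.add_left a a' b) f s

theorem sum_right (hh : IsPosDefHermitian h) {ι : Type*} (s : Finset ι) (a : W) (f : ι → W) :
    h a (∑ i ∈ s, f i) = ∑ i ∈ s, h a (f i) :=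
  map_sum (AddMonoidHom.mk' (fun b => h a b) fun b b' => hh.add_right a b b') f s

theorem nonneg (hh : IsPosDefHermitian h) (a : W) : 0 ≤ h a a := by
  by_cases ha : a = 0
  · rw [ha, hh.zero_left]
  · exact (hh.pos a ha).le

theorem eq_zero (hh : IsPosDefHermitian h) {a : W} (ha : h a a = 0) : a = 0 := by
  by_contra hne
  exact (hh.pos a hne).ne' ha

/-- A positive definite hermitian form separates vectors. -/
theorem ext_left (hh : IsPosDefHermitian h) {a a' : W} (H : ∀ b, h a b = h a' b) : a = a' := by
  rw [← sub_eq_zero]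
  exact hh.eq_zero (by rw [hh.sub_left, H, sub_self])

theorem ext_basis (hh : IsPosDefHermitian h) {ι : Type*} [Fintype ι] (B : Module.Basis ι ℂ W)
    {a a' : W} (H : ∀ i, h a (B i) = h a' (B i)) : a = a' := by
  refine hh.ext_left fun b => ?_
  rw [← B.sum_repr b, hh.sum_right, hh.sum_right]
  simp only [hh.smul_right, H]

theorem ofReal_re (hh : IsPosDefHermitian h) (a : W) : ((h a a).re : ℂ) = h a a :=
  Complex.conj_eq_iff_re.mp (hh.conj_symm a a).symm

variable {ι : Type*} [Fintype ι] [DecidableEq ι]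

/-- A finite dimensional space has a basis which is orthonormal for a given positive definite
hermitian form. -/
theorem exists_orthonormal_basis (hh : IsPosDefHermitian h) [FiniteDimensional ℂ W] :
    ∃ B : Module.Basis (Fin (Module.finrank ℂ W)) ℂ W,
      ∀ i j, h (B i) (B j) = if i = j then 1 else 0 := by
  let core : InnerProductSpace.Core ℂ W :=
    { inner := fun x y => h y x
      conj_inner_symm := fun x y => (hh.conj_symm x y).symm
      re_inner_nonneg := fun x => (Complex.nonneg_iff.mp (hh.nonneg x)).1
      add_left := fun x y z => hh.add_right z x y
      smul_left := fun x y r => hh.smul_right r y x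
      definite := fun x hx => hh.eq_zero hx }
  let _ : NormedAddCommGroup W := core.toNormedAddCommGroup
  let _ : InnerProductSpace ℂ W := InnerProductSpace.ofCore core.toCore
  let o := stdOrthonormalBasis ℂ W
  refine ⟨o.toBasis, fun i j => ?_⟩
  have h1 : h (o i) (o j) = if j = i then 1 else 0 := orthonormal_iff_ite.mp o.orthonormal j i
  rw [OrthonormalBasis.coe_toBasis, h1]
  simp [eq_comm]

/-- The dual family exists: the choice in `dualFamily` is not a junk value. -/
theorem dualFamily_spec (hh : IsPosDefHermitian h) (B : Module.Basis ι ℂ W) (i j : ι) :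
    h (B i) (dualFamily h B j) = if i = j then 1 else 0 := by
  have : FiniteDimensional ℂ W := B.finiteDimensional_of_finite
  obtain ⟨O, hO⟩ := hh.exists_orthonormal_basis
  have key : ∃ d : ι → W, ∀ i j, h (B i) (d j) = if i = j then 1 else 0 := by
    refine ⟨fun j => ∑ k, conj (B.repr (O k) j) • O k, fun i j => ?_⟩
    have h1 : B i = ∑ k, O.repr (B i) k • O k := (O.sum_repr _).symm
    have h2 : ∀ k, h (B i) (O k) = O.repr (B i) k := fun k => by
      conv_lhs => rw [h1]
      rw [hh.sum_left]
      simp [hh.smul_left, hO]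
    rw [hh.sum_right]
    simp only [hh.smul_right, Complex.conj_conj, h2]
    have h3 : B.repr (B i) j = ∑ k, O.repr (B i) k * B.repr (O k) j := by
      have h4 := congrArg (fun w => B.repr w j) h1
      simpa only [map_sum, Finsupp.finsetSum_apply, map_smul, Finsupp.smul_apply,
        smul_eq_mul] using h4
    rw [B.repr_self, Finsupp.single_apply] at h3
    rw [h3]
    exact Finset.sum_congr rfl fun k _ => mul_comm _ _
  exact Classical.epsilon_spec key i j

theorem repr_eq (hh : IsPosDefHermitian h) (B : Module.Basis ι ℂ W) (v : W) (j : ι) :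
    B.repr v j = h v (dualFamily h B j) := by
  conv_rhs => rw [← B.sum_repr v]
  rw [hh.sum_left]
  simp [hh.smul_left, hh.dualFamily_spec]

/-- The form `endForm` is `(P, Q) ↦ tr (Q† P)`, where `Q†` is the adjoint of `Q`. -/
theorem endForm_eq_trace (hh : IsPosDefHermitian h) (B : Module.Basis ι ℂ W)
    {P Q Q' : Module.End ℂ W} (hQ : ∀ a b, h a (Q b) = h (Q' a) b) :
    endForm h B P Q = LinearMap.trace ℂ W (Q' * P) := by
  rw [LinearMap.trace_eq_matrix_trace ℂ B, Matrix.trace, endForm]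
  refine Finset.sum_congr rfl fun i _ => ?_
  rw [Matrix.diag_apply, LinearMap.toMatrix_apply, hh.repr_eq, hQ]
  rfl

end IsPosDefHermitian

variable {ι : Type*} [Fintype ι] [DecidableEq ι]

/-- The Gram matrix of `h`, arranged so that `h a b = b† H a` in coordinates. -/
def gram (h : W → W → ℂ) (B : ι → W) : Matrix ι ι ℂ := Matrix.of fun j i => h (B i) (B j)

namespace IsPosDefHermitian

theorem eq_gram (hh : IsPosDefHermitian h) {ι : Type*} [Fintype ι]
    (B : Module.Basis ι ℂ W) (a b : W) :
    h a b = star (B.equivFun b) ⬝ᵥ (gram h B *ᵥ B.equivFun a) := by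
  conv_lhs => rw [← B.sum_repr a, ← B.sum_repr b]
  rw [hh.sum_right]
  simp only [hh.smul_right, hh.sum_left, hh.smul_left, dotProduct, mulVec, gram, Matrix.of_apply]
  refine Finset.sum_congr rfl fun j _ => ?_
  simp only [Pi.star_apply, Module.Basis.equivFun_apply, RCLike.star_def]
  congr 1
  exact Finset.sum_congr rfl fun i _ => mul_comm _ _

theorem gram_conjTranspose (hh : IsPosDefHermitian h) {ι : Type*} (B : ι → W) :
    (gram h B)ᴴ = gram h B := by
  ext i j
  rw [conjTranspose_apply, gram, Matrix.of_apply, Matrix.of_apply, hh.conj_symm (B i)]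
  simp

theorem isUnit_gram (hh : IsPosDefHermitian h) (B : Module.Basis ι ℂ W) :
    IsUnit (gram h B) := by
  rw [← Matrix.mulVec_injective_iff_isUnit]
  refine (injective_iff_map_eq_zero (gram h B).mulVecLin).mpr fun a ha => ?_
  obtain ⟨v, rfl⟩ := B.equivFun.surjective a
  have h1 : gram h B *ᵥ B.equivFun v = 0 := ha
  rw [hh.eq_zero (a := v) (by rw [hh.eq_gram B, h1, dotProduct_zero]), map_zero]

/-- In a basis, the adjoint of `Q` has the matrix `H⁻¹ Qᴴ H`. -/
theorem toMatrix_adjoint (hh : IsPosDefHermitian h) (B : Module.Basis ι ℂ W)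
    {Q Q' : Module.End ℂ W} (hQ : ∀ a b, h a (Q b) = h (Q' a) b) :
    LinearMap.toMatrix B B Q' =
      (gram h B)⁻¹ * (LinearMap.toMatrix B B Q)ᴴ * gram h B := by
  have key : gram h B * LinearMap.toMatrix B B Q' = (LinearMap.toMatrix B B Q)ᴴ * gram h B := by
    ext j i
    have h1 := hQ (B i) (B j)
    rw [hh.eq_gram B, hh.eq_gram B] at h1
    have h2 : ∀ (P : Module.End ℂ W) k, B.equivFun (P (B k)) =
        fun l => LinearMap.toMatrix B B P l k := fun P k => by
      ext l; rw [LinearMap.toMatrix_apply]; rfl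
    have h3 : ∀ k, B.equivFun (B k) = Pi.single k 1 := fun k => by
      ext l; simp [Pi.single_apply, eq_comm]
    rw [h2, h2, h3, h3] at h1
    simpa [dotProduct, mulVec, Matrix.mul_apply, Pi.single_apply, ← Pi.single_star] using h1.symm
  have hu := (Matrix.isUnit_iff_isUnit_det _).mp (hh.isUnit_gram B)
  rw [mul_assoc, ← key, ← mul_assoc, Matrix.nonsing_inv_mul _ hu, one_mul]

theorem exists_adjoint (hh : IsPosDefHermitian h) [FiniteDimensional ℂ W] (Q : Module.End ℂ W) :
    ∃ Q' : Module.End ℂ W, ∀ a b, h a (Q b) = h (Q' a) b := by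
  obtain ⟨O, hO⟩ := hh.exists_orthonormal_basis
  let L : W → (W →ₗ[ℂ] ℂ) := fun w =>
    { toFun := fun a => h a w
      map_add' := fun a a' => hh.add_left a a' w
      map_smul' := fun c a => hh.smul_left c a w }
  refine ⟨∑ i, (L (Q (O i))).smulRight (O i), fun a b => ?_⟩
  conv_lhs => rw [← O.sum_repr b, map_sum, hh.sum_right]
  rw [LinearMap.sum_apply, hh.sum_left]
  refine Finset.sum_congr rfl fun i _ => ?_
  rw [LinearMap.smulRight_apply, hh.smul_left, map_smul, hh.smul_right, mul_comm]
  congr 1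
  conv_rhs => rw [← O.sum_repr b]
  rw [hh.sum_right]
  simp [hh.smul_right, hO]

/-- The trace formula for `endForm`, valid in every basis `B`. -/
theorem endForm_eq_matrix (hh : IsPosDefHermitian h) {ι' : Type*} [Fintype ι'] [DecidableEq ι']
    (e : Module.Basis ι' ℂ W) (B : Module.Basis ι ℂ W) (P Q : Module.End ℂ W) :
    endForm h e P Q = Matrix.trace (LinearMap.toMatrix B B P * (gram h B)⁻¹ *
      (LinearMap.toMatrix B B Q)ᴴ * gram h B) := by
  have : FiniteDimensional ℂ W := B.finiteDimensional_of_finite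
  obtain ⟨Q', hQ'⟩ := hh.exists_adjoint Q
  rw [hh.endForm_eq_trace e hQ', LinearMap.trace_eq_matrix_trace ℂ B, LinearMap.toMatrix_mul,
    hh.toMatrix_adjoint B hQ', Matrix.trace_mul_comm]
  simp only [Matrix.mul_assoc]

/-- A positive definite hermitian form on `W` induces a positive definite hermitian form on
`End W`. -/
theorem endForm (hh : IsPosDefHermitian h) (e : Module.Basis ι ℂ W) :
    IsPosDefHermitian (endForm h e) := by
  have : FiniteDimensional ℂ W := e.finiteDimensional_of_finite
  obtain ⟨O, hO⟩ := hh.exists_orthonormal_basis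
  have hg : gram h O = 1 := by
    ext i j
    rw [gram, Matrix.of_apply, hO, Matrix.one_apply]
    simp [eq_comm]
  have key : ∀ P Q, TTStar.endForm h e P Q =
      Matrix.trace (LinearMap.toMatrix O O P * (LinearMap.toMatrix O O Q)ᴴ) := fun P Q => by
    rw [hh.endForm_eq_matrix e O, hg]
    simp
  refine ⟨fun a a' b => ?_, fun c a b => ?_, fun a b => ?_, fun a ha => ?_⟩
  · simp [key, add_mul]
  · simp [key]
  · rw [key, key, ← RCLike.star_def, ← Matrix.trace_conjTranspose]
    simp
  · have h1 := (Matrix.posSemidef_self_mul_conjTranspose (LinearMap.toMatrix O O a)).trace_nonneg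
    refine lt_of_le_of_ne (by rw [key]; exact h1) fun h2 => ha ?_
    rw [key] at h2
    simpa using Matrix.trace_mul_conjTranspose_self_eq_zero_iff.mp h2.symm

/-- A nilpotent endomorphism that commutes with its adjoint is zero. -/
theorem eq_zero_of_isNilpotent_of_commute (hh : IsPosDefHermitian h) {P P' : Module.End ℂ W}
    (hP : ∀ a b, h a (P b) = h (P' a) b) (hc : Commute P P') (hn : IsNilpotent P) : P = 0 := by
  have hP' : ∀ a b, h a (P' b) = h (P a) b := fun a b => by
    rw [hh.conj_symm, ← hP, ← hh.conj_symm]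
  -- for a self-adjoint `T`, the form `h (T a) (T a) = h (T ^ 2 a) a` detects `T`
  have hs : ∀ T : Module.End ℂ W, (∀ a b, h a (T b) = h (T a) b) →
      ∀ k : ℕ, T ^ 2 ^ k = 0 → T = 0 := by
    intro T hT k
    have hTp : ∀ m a b, h a ((T ^ m) b) = h ((T ^ m) a) b := by
      intro m
      induction m with
      | zero => simp
      | succ m ih =>
        intro a b
        rw [pow_succ, Module.End.mul_apply, ih, hT, ← Module.End.mul_apply, ← pow_succ', pow_succ]
    induction k with
    | zero => simp
    | succ k ih =>
      intro h0
      refine ih (LinearMap.ext fun a => hh.eq_zero ?_)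
      rw [hTp, ← Module.End.mul_apply, ← pow_add, ← two_mul, ← pow_succ', h0,
        LinearMap.zero_apply, hh.zero_left]
  have h1 : IsNilpotent (P' * P) := hc.symm.isNilpotent_mul_left hn
  obtain ⟨m, hm⟩ := h1
  have h2 : P' * P = 0 := hs _ (fun a b => by
    rw [Module.End.mul_apply, hP', hP, ← Module.End.mul_apply]) m
    (pow_eq_zero_of_le Nat.lt_two_pow_self.le hm)
  refine LinearMap.ext fun a => hh.eq_zero ?_
  rw [hP, ← Module.End.mul_apply, h2, LinearMap.zero_apply, hh.zero_left]

end IsPosDefHermitian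

end HermitianAlgebra

/-! ### Wirtinger derivatives on a complex vector space -/

section Wirtinger

variable {E : Type*} [NormedAddCommGroup E] [NormedSpace ℂ E]
  {G : Type*} [NormedAddCommGroup G] [NormedSpace ℂ G]
  {G' : Type*} [NormedAddCommGroup G'] [NormedSpace ℂ G']

/-- The directional derivative `(df(X) + c df(iX)) / 2`. The values `c = -i` and `c = i` give the
Wirtinger derivatives `∂_X f` and `∂_X̄ f`; both obey the same product rule. -/
noncomputable def wirtinger (c : ℂ) (X : E) (f : E → G) (y : E) : G :=
  (1 / 2 : ℂ) • (fderiv ℝ f y X + c • fderiv ℝ f y (Complex.I • X))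

theorem wirtinger_congr (c : ℂ) (X : E) {f g : E → G} {y : E} (hfg : f =ᶠ[𝓝 y] g) :
    wirtinger c X f y = wirtinger c X g y := by
  rw [wirtinger, wirtinger, hfg.fderiv_eq]

theorem wirtinger_const (c : ℂ) (X : E) (a : G) (y : E) :
    wirtinger c X (fun _ => a) y = 0 := by
  simp [wirtinger]

theorem wirtinger_add (c : ℂ) (X : E) {f g : E → G} {y : E} (hf : DifferentiableAt ℝ f y)
    (hg : DifferentiableAt ℝ g y) :
    wirtinger c X (fun z => f z + g z) y = wirtinger c X f y + wirtinger c X g y := by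
  rw [wirtinger, wirtinger, wirtinger, fderiv_fun_add hf hg]
  simp only [add_apply]
  module

theorem wirtinger_sub (c : ℂ) (X : E) {f g : E → G} {y : E} (hf : DifferentiableAt ℝ f y)
    (hg : DifferentiableAt ℝ g y) :
    wirtinger c X (fun z => f z - g z) y = wirtinger c X f y - wirtinger c X g y := by
  rw [wirtinger, wirtinger, wirtinger, fderiv_fun_sub hf hg]
  simp only [sub_apply]
  module

theorem wirtinger_sum (c : ℂ) (X : E) {ι : Type*} (s : Finset ι) {f : ι → E → G} {y : E}
    (hf : ∀ i ∈ s, DifferentiableAt ℝ (f i) y) :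
    wirtinger c X (fun z => ∑ i ∈ s, f i z) y = ∑ i ∈ s, wirtinger c X (f i) y := by
  simp only [wirtinger, fderiv_fun_sum hf, sum_apply, Finset.smul_sum,
    ← Finset.sum_add_distrib]

theorem wirtinger_clm (c : ℂ) (X : E) (l : G →L[ℂ] G') {f : E → G} {y : E}
    (hf : DifferentiableAt ℝ f y) :
    wirtinger c X (fun z => l (f z)) y = l (wirtinger c X f y) := by
  have h1 : fderiv ℝ (fun z => l (f z)) y = (l.restrictScalars ℝ).comp (fderiv ℝ f y) :=
    ((l.restrictScalars ℝ).hasFDerivAt.comp y hf.hasFDerivAt).fderiv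
  simp [wirtinger, h1]

theorem wirtinger_mul {𝔸 : Type*} [NormedRing 𝔸] [NormedAlgebra ℂ 𝔸] (c : ℂ) (X : E)
    {f g : E → 𝔸} {y : E} (hf : DifferentiableAt ℝ f y) (hg : DifferentiableAt ℝ g y) :
    wirtinger c X (fun z => f z * g z) y =
      wirtinger c X f y * g y + f y * wirtinger c X g y := by
  rw [wirtinger, wirtinger, wirtinger, fderiv_fun_mul' hf hg]
  simp only [add_apply, smul_apply, smul_eq_mul,
    MulOpposite.smul_eq_mul_unop, MulOpposite.unop_op, smul_add, smul_mul_assoc, mul_smul_comm,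
    mul_add, add_mul]
  abel

/-- Conjugation exchanges the two Wirtinger derivatives. -/
theorem wirtinger_star [StarAddMonoid G] [StarModule ℂ G] [NormedStarGroup G] (c : ℂ) (X : E)
    {f : E → G} {y : E} :
    wirtinger c X (fun z => star (f z)) y = star (wirtinger (conj c) X f y) := by
  have h1 : fderiv ℝ (fun z => star (f z)) y =
      (((starL' ℝ : G ≃L[ℝ] G) : G →L[ℝ] G)).comp (fderiv ℝ f y) := fderiv_star
  simp [wirtinger, h1, star_smul]

/-- The operator `∂_X̄` kills holomorphic functions. -/
theorem wirtingerBar_of_differentiableAt (X : E) {f : E → G} {y : E}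
    (hf : DifferentiableAt ℂ f y) : wirtinger Complex.I X f y = 0 := by
  have h1 : fderiv ℝ f y = (fderiv ℂ f y).restrictScalars ℝ := hf.fderiv_restrictScalars ℝ
  simp [wirtinger, h1, smul_smul]

theorem wirtinger_of_differentiableAt (X : E) {f : E → G} {y : E}
    (hf : DifferentiableAt ℂ f y) : wirtinger (-Complex.I) X f y = fderiv ℂ f y X := by
  have h1 : fderiv ℝ f y = (fderiv ℂ f y).restrictScalars ℝ := hf.fderiv_restrictScalars ℝ
  simp [wirtinger, h1, smul_smul, ← two_smul ℂ]

theorem differentiableAt_wirtinger (c : ℂ) (X : E) {f : E → G} {y : E}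
    (hf : ContDiffAt ℝ 2 f y) : DifferentiableAt ℝ (wirtinger c X f) y := by
  have h1 : DifferentiableAt ℝ (fderiv ℝ f) y :=
    (hf.fderiv_right (m := 1) (by norm_num [one_add_one_eq_two])).differentiableAt one_ne_zero
  unfold wirtinger
  have h2 : ∀ Z : E, DifferentiableAt ℝ (fun z => fderiv ℝ f z Z) y := fun Z =>
    h1.clm_apply (differentiableAt_const Z)
  exact ((h2 X).add ((h2 _).const_smul c)).const_smul (1 / 2 : ℂ)

/-- The derivative `∂_X` of a holomorphic function is again holomorphic. -/
theorem differentiableAt_wirtinger_of_hol [CompleteSpace G] (X : E) {f : E → G} {y : E}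
    (hf : ContDiffAt ℂ ω f y) : DifferentiableAt ℂ (wirtinger (-Complex.I) X f) y := by
  have h1 : DifferentiableAt ℂ (fderiv ℂ f) y :=
    (hf.fderiv_right (m := ω) le_top).differentiableAt (by simp)
  have h2 : ∀ᶠ z in 𝓝 y, DifferentiableAt ℂ f z := by
    filter_upwards [hf.eventually (by simp)] with z hz using hz.differentiableAt (by simp)
  refine DifferentiableAt.congr_of_eventuallyEq (h1.clm_apply (differentiableAt_const X)) ?_
  filter_upwards [h2] with z hz using wirtinger_of_differentiableAt X hz

end Wirtinger

/-! ### The second derivatives of `tr (A A*)` for a holomorphic `A` -/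

section TraceForm

variable {E : Type*} [NormedAddCommGroup E] [NormedSpace ℂ E]
  {𝔸 : Type*} [NormedRing 𝔸] [NormedAlgebra ℂ 𝔸] [StarRing 𝔸]

local notation "∂[" X "]" => wirtinger (-Complex.I) X
local notation "∂bar[" X "]" => wirtinger Complex.I X

/-- A hermitian metric in a holomorphic frame near `y`: `H` is its Gram matrix, `J` the inverse
of `H`. -/
structure IsMetricNear (H J : E → 𝔸) (y : E) : Prop where
  contDiffAt : ContDiffAt ℝ 2 H y
  contDiffAt_inv : ContDiffAt ℝ 2 J y
  mul_inv : ∀ᶠ z in 𝓝 y, H z * J z = 1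
  inv_mul : ∀ᶠ z in 𝓝 y, J z * H z = 1
  star_eq : ∀ᶠ z in 𝓝 y, star (H z) = H z

/-- The connection form `Γ = H⁻¹ ∂_X H` of the Chern connection. -/
noncomputable def connForm (H J : E → 𝔸) (X : E) (z : E) : 𝔸 := J z * ∂[X] H z

/-- The `(1,0)`-derivative `∂_X A + [Γ, A]` of an endomorphism in a holomorphic frame. -/
noncomputable def endDeriv (H J A : E → 𝔸) (X : E) (z : E) : 𝔸 :=
  ∂[X] A z + (connForm H J X z * A z - A z * connForm H J X z)

variable {H J : E → 𝔸} {y : E}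

namespace IsMetricNear

theorem eventually (hH : IsMetricNear H J y) : ∀ᶠ z in 𝓝 y, IsMetricNear H J z := by
  filter_upwards [hH.contDiffAt.eventually (by simp), hH.contDiffAt_inv.eventually (by simp),
    hH.mul_inv.eventually_nhds, hH.inv_mul.eventually_nhds, hH.star_eq.eventually_nhds]
    with z h1 h2 h3 h4 h5 using ⟨h1, h2, h3, h4, h5⟩

theorem diff (hH : IsMetricNear H J y) : DifferentiableAt ℝ H y :=
  hH.contDiffAt.differentiableAt (by simp)

theorem diff_inv (hH : IsMetricNear H J y) : DifferentiableAt ℝ J y :=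
  hH.contDiffAt_inv.differentiableAt (by simp)

theorem star_inv (hH : IsMetricNear H J y) : star (J y) = J y := by
  have h1 := hH.mul_inv.self_of_nhds
  have h2 := hH.inv_mul.self_of_nhds
  have h3 := congrArg star h2
  rw [star_mul, hH.star_eq.self_of_nhds, star_one] at h3
  exact (left_inv_eq_right_inv h2 h3).symm

theorem mul_connForm (hH : IsMetricNear H J y) (X : E) : H y * connForm H J X y = ∂[X] H y := by
  rw [connForm, ← mul_assoc, hH.mul_inv.self_of_nhds, one_mul]

theorem wirtinger_inv (hH : IsMetricNear H J y) (X : E) :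
    ∂[X] J y = -(connForm H J X y * J y) := by
  have h1 : ∂[X] (fun z => H z * J z) y = 0 := by
    rw [wirtinger_congr _ X hH.mul_inv, wirtinger_const]
  rw [wirtinger_mul _ X hH.diff hH.diff_inv] at h1
  have h2 : J y * (H y * ∂[X] J y) = -(J y * (∂[X] H y * J y)) := by
    rw [eq_neg_iff_add_eq_zero, ← mul_add, add_comm, h1, mul_zero]
  rw [← mul_assoc, hH.inv_mul.self_of_nhds, one_mul] at h2
  rw [h2, connForm, mul_assoc]

theorem differentiableAt_connForm (hH : IsMetricNear H J y) (X : E) :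
    DifferentiableAt ℝ (connForm H J X) y :=
  hH.diff_inv.mul (differentiableAt_wirtinger _ X hH.contDiffAt)

variable [StarModule ℂ 𝔸] [NormedStarGroup 𝔸]

theorem wirtingerBar (hH : IsMetricNear H J y) (X : E) :
    ∂bar[X] H y = star (connForm H J X y) * H y := by
  have h1 : ∂bar[X] H y = ∂bar[X] (fun z => star (H z)) y :=
    wirtinger_congr _ X (hH.star_eq.mono fun z hz => hz.symm)
  rw [h1, wirtinger_star, Complex.conj_I, ← hH.mul_connForm, star_mul, hH.star_eq.self_of_nhds]

theorem wirtingerBar_inv (hH : IsMetricNear H J y) (X : E) :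
    ∂bar[X] J y = -(J y * star (connForm H J X y)) := by
  have h1 : ∂bar[X] J y = ∂bar[X] (fun z => star (J z)) y :=
    wirtinger_congr _ X (hH.eventually.mono fun z hz => hz.star_inv.symm)
  rw [h1, wirtinger_star, Complex.conj_I, hH.wirtinger_inv, star_neg, star_mul, hH.star_inv]

/-- Lowering an index in the curvature `-∂bar Γ`. -/
theorem mul_wirtingerBar_connForm (hH : IsMetricNear H J y) (X : E) :
    H y * ∂bar[X] (connForm H J X) y =
      ∂bar[X] (∂[X] H) y - star (connForm H J X y) * H y * connForm H J X y := by
  have h1 : ∂bar[X] (fun z => H z * connForm H J X z) y = ∂bar[X] (∂[X] H) y :=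
    wirtinger_congr _ X (hH.eventually.mono fun z hz => hz.mul_connForm X)
  rw [wirtinger_mul _ X hH.diff (hH.differentiableAt_connForm X), hH.wirtingerBar] at h1
  rw [← h1]
  abel

/-- The first derivative of the trace form: `∂_X tr (A B*) = tr ((D_X A) B*)`, since `B*` is
covariantly antiholomorphic. -/
theorem wirtinger_trace (hH : IsMetricNear H J y) (tr : 𝔸 →L[ℂ] ℂ)
    (htr : ∀ a b, tr (a * b) = tr (b * a)) {A B : E → 𝔸} (hA : DifferentiableAt ℂ A y)
    (hB : DifferentiableAt ℂ B y) (X : E) :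
    ∂[X] (fun z => tr (A z * J z * star (B z) * H z)) y =
      tr (endDeriv H J A X y * J y * star (B y) * H y) := by
  have hA' := hA.restrictScalars ℝ
  have hB' : DifferentiableAt ℝ (fun z => star (B z)) y := (hB.restrictScalars ℝ).star
  have h1 := hA'.fun_mul hH.diff_inv
  have h2 := h1.fun_mul hB'
  have h3 : ∂[X] (fun z => star (B z)) y = 0 := by
    rw [wirtinger_star, map_neg, Complex.conj_I, neg_neg, wirtingerBar_of_differentiableAt X hB,
      star_zero]
  rw [wirtinger_clm _ X tr (h2.fun_mul hH.diff), wirtinger_mul _ X h2 hH.diff,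
    wirtinger_mul _ X h1 hB', wirtinger_mul _ X hA' hH.diff_inv, h3, hH.wirtinger_inv,
    ← hH.mul_connForm, endDeriv]
  have h4 : tr (A y * J y * star (B y) * (H y * connForm H J X y)) =
      tr (connForm H J X y * A y * J y * star (B y) * H y) := by
    rw [← mul_assoc, htr]; simp only [mul_assoc]
  simp only [mul_zero, add_zero, add_mul, sub_mul, map_add, map_sub, mul_neg, neg_mul, map_neg, h4]
  simp only [mul_assoc]
  ring

/-- The second derivative of the trace form of a holomorphic endomorphism. Here the curvature
`-∂bar Γ` enters through the commutator. -/
theorem wirtingerBar_wirtinger_trace [CompleteSpace 𝔸] (hH : IsMetricNear H J y) (tr : 𝔸 →L[ℂ] ℂ)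
    (htr : ∀ a b, tr (a * b) = tr (b * a)) {A : E → 𝔸} (hA : ContDiffAt ℂ ω A y) (X : E) :
    ∂bar[X] (∂[X] fun z => tr (A z * J z * star (A z) * H z)) y =
      tr ((∂bar[X] (connForm H J X) y * A y - A y * ∂bar[X] (connForm H J X) y) *
        J y * star (A y) * H y) +
      tr (endDeriv H J A X y * J y * star (endDeriv H J A X y) * H y) := by
  have hev : ∀ᶠ z in 𝓝 y, DifferentiableAt ℂ A z := by
    filter_upwards [hA.eventually (by simp)] with z hz using hz.differentiableAt (by simp)
  have hAy := hev.self_of_nhds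
  have hA' := hAy.restrictScalars ℝ
  have hsA : DifferentiableAt ℝ (fun z => star (A z)) y := hA'.star
  have hdA := differentiableAt_wirtinger_of_hol X hA
  have hΓ := hH.differentiableAt_connForm X
  have hD : DifferentiableAt ℝ (endDeriv H J A X) y :=
    (hdA.restrictScalars ℝ).add ((hΓ.fun_mul hA').fun_sub (hA'.fun_mul hΓ))
  have h1 : ∂bar[X] (∂[X] fun z => tr (A z * J z * star (A z) * H z)) y =
      ∂bar[X] (fun z => tr (endDeriv H J A X z * J z * star (A z) * H z)) y := by
    refine wirtinger_congr _ X ?_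
    filter_upwards [hev, hH.eventually] with z hz hz' using hz'.wirtinger_trace tr htr hz hz X
  have h2 : ∂bar[X] (endDeriv H J A X) y =
      ∂bar[X] (connForm H J X) y * A y - A y * ∂bar[X] (connForm H J X) y := by
    unfold endDeriv
    rw [wirtinger_add _ X (hdA.restrictScalars ℝ) ((hΓ.fun_mul hA').fun_sub (hA'.fun_mul hΓ)),
      wirtinger_sub _ X (hΓ.fun_mul hA') (hA'.fun_mul hΓ), wirtinger_mul _ X hΓ hA',
      wirtinger_mul _ X hA' hΓ, wirtingerBar_of_differentiableAt X hdA,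
      wirtingerBar_of_differentiableAt X hAy]
    simp
  have h3 : ∂bar[X] (fun z => star (A z)) y = star (∂[X] A y) := by
    rw [wirtinger_star, Complex.conj_I]
  have e1 := hD.fun_mul hH.diff_inv
  have e2 := e1.fun_mul hsA
  rw [h1, wirtinger_clm _ X tr (e2.fun_mul hH.diff), wirtinger_mul _ X e2 hH.diff,
    wirtinger_mul _ X e1 hsA, wirtinger_mul _ X hD hH.diff_inv, h2, h3, hH.wirtingerBar_inv,
    hH.wirtingerBar, ← map_add]
  congr 1
  have h4 : star (endDeriv H J A X y) = star (∂[X] A y) + (star (A y) * star (connForm H J X y) -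
      star (connForm H J X y) * star (A y)) := by
    simp [endDeriv]
  rw [h4]
  noncomm_ring

end IsMetricNear

end TraceForm

/-! ### Derivatives on a complex manifold in a chart -/

section RealStructure

variable {E : Type*} [NormedAddCommGroup E] [NormedSpace ℂ E]
  {M : Type*} [TopologicalSpace M] [ChartedSpace E M]
  {G : Type*} [NormedAddCommGroup G] [NormedSpace ℂ G]

theorem contMDiffAt_real_iff {n : ℕ∞ω} {f : M → G} {t : M} :
    ContMDiffAt 𝓘(ℝ, E) 𝓘(ℝ, G) n f t ↔
      ContinuousAt f t ∧ ContDiffAt ℝ n (f ∘ (chartAt E t).symm) (chartAt E t t) := by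
  rw [contMDiffAt_iff, ← contDiffWithinAt_univ]
  simp [mfld_simps, chartAt_self_eq, Function.comp_def]

theorem contMDiffAt_complex_iff {n : ℕ∞ω} {f : M → G} {t : M} :
    ContMDiffAt 𝓘(ℂ, E) 𝓘(ℂ, G) n f t ↔
      ContinuousAt f t ∧ ContDiffAt ℂ n (f ∘ (chartAt E t).symm) (chartAt E t t) := by
  rw [contMDiffAt_iff, ← contDiffWithinAt_univ]
  simp [mfld_simps, chartAt_self_eq, Function.comp_def]

/-- A holomorphic function is smooth in the real sense. -/
theorem contMDiffAt_real_of_complex {n : ℕ∞ω} {f : M → G} {t : M}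
    (hf : ContMDiffAt 𝓘(ℂ, E) 𝓘(ℂ, G) n f t) : ContMDiffAt 𝓘(ℝ, E) 𝓘(ℝ, G) n f t := by
  rw [contMDiffAt_complex_iff] at hf
  exact contMDiffAt_real_iff.mpr ⟨hf.1, hf.2.restrict_scalars ℝ⟩

/-- The real differential of a holomorphic function is its complex differential. -/
theorem hasMFDerivAt_real_of_complex {f : M → G} {t : M} {f' : E →L[ℂ] G}
    (hf : HasMFDerivAt 𝓘(ℂ, E) 𝓘(ℂ, G) f t f') :
    HasMFDerivAt 𝓘(ℝ, E) 𝓘(ℝ, G) f t (f'.restrictScalars ℝ : E →L[ℝ] G) := by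
  refine ⟨hf.1, ?_⟩
  have h1 := hf.2
  simp only [mfld_simps, chartAt_self_eq] at h1 ⊢
  exact HasFDerivWithinAt.restrictScalars ℝ h1

variable [IsManifold 𝓘(ℂ, E) ω M]

/-- Constant vector fields in the chart at `t` differentiate functions like directional
derivatives in that chart. -/
theorem realDeriv_symm {f : M → G} {t x : M} (hx : x ∈ (chartAt E t).source)
    (hf : DifferentiableAt ℝ (f ∘ (chartAt E t).symm) (chartAt E t x)) (X : E) :
    realDeriv f x ((trivializationAt E (TangentSpace 𝓘(ℂ, E)) t).symm x X) =
      fderiv ℝ (f ∘ (chartAt E t).symm) (chartAt E t x) X := by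
  have h1 : HasMFDerivAt 𝓘(ℂ, E) 𝓘(ℂ, E) (chartAt E t) x
      ((trivializationAt E (TangentSpace 𝓘(ℂ, E)) t).continuousLinearMapAt ℂ x) := by
    rw [TangentBundle.continuousLinearMapAt_trivializationAt hx]
    have := (mdifferentiableAt_extChartAt (I := 𝓘(ℂ, E)) hx).hasMFDerivAt
    simpa only [mfld_simps] using this
  have h2 := hasMFDerivAt_real_of_complex h1
  have h3 : HasMFDerivAt 𝓘(ℝ, E) 𝓘(ℝ, G) (f ∘ (chartAt E t).symm) (chartAt E t x)
      (fderiv ℝ (f ∘ (chartAt E t).symm) (chartAt E t x)) := hf.hasFDerivAt.hasMFDerivAt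
  have h4 := h3.comp x h2
  have h5 : f =ᶠ[𝓝 x] (f ∘ (chartAt E t).symm) ∘ chartAt E t := by
    filter_upwards [(chartAt E t).open_source.mem_nhds hx] with z hz
    simp [(chartAt E t).left_inv hz]
  have h6 := (h4.congr_of_eventuallyEq h5).mfderiv
  unfold realDeriv
  rw [h6]
  rw [← Trivialization.symmL_apply (R := ℂ) _ hx]
  have h7 := (trivializationAt E (TangentSpace 𝓘(ℂ, E)) t).continuousLinearMapAt_symmL
    (R := ℂ) hx X
  exact congrArg (fderiv ℝ (f ∘ (chartAt E t).symm) (chartAt E t x)) h7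

theorem tangent_symm_smul {t x : M} (hx : x ∈ (chartAt E t).source) (c : ℂ) (X : E) :
    (trivializationAt E (TangentSpace 𝓘(ℂ, E)) t).symm x (c • X) =
      c • (trivializationAt E (TangentSpace 𝓘(ℂ, E)) t).symm x X := by
  rw [← Trivialization.symmL_apply (R := ℂ) _ hx, ← Trivialization.symmL_apply (R := ℂ) _ hx,
    map_smul]

theorem del_symm {f : M → G} {t x : M} (hx : x ∈ (chartAt E t).source)
    (hf : DifferentiableAt ℝ (f ∘ (chartAt E t).symm) (chartAt E t x)) (X : E) :
    del f x ((trivializationAt E (TangentSpace 𝓘(ℂ, E)) t).symm x X) =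
      wirtinger (-Complex.I) X (f ∘ (chartAt E t).symm) (chartAt E t x) := by
  rw [del, wirtinger, ← tangent_symm_smul hx, realDeriv_symm hx hf, realDeriv_symm hx hf,
    neg_smul, sub_eq_add_neg]

/-- The identification of the tangent space at `t` with the model space by the preferred chart
at `t`. -/
def toModel (t : M) : TangentSpace 𝓘(ℂ, E) t ≃ₗ[ℂ] E := LinearEquiv.refl ℂ E

theorem tangent_symm_toModel (t : M) (X : TangentSpace 𝓘(ℂ, E) t) :
    (trivializationAt E (TangentSpace 𝓘(ℂ, E)) t).symm t (toModel t X) = X := by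
  have h1 := TangentBundle.symmL_trivializationAt_eq_core (I := 𝓘(ℂ, E)) (mem_chart_source E t)
  have h2 := congrArg (fun l : E →L[ℂ] E => l X) h1
  rw [← Trivialization.symmL_apply (R := ℂ) _ (mem_chart_source E t)]
  refine h2.trans ?_
  exact (tangentBundleCore 𝓘(ℂ, E) M).coordChange_self (achart E t) t (mem_chart_source E t) X

/-- The extension `localExt` of a tangent vector is the vector field which is constant in the
chart. -/
theorem tangent_localExt {t : M} (X : TangentSpace 𝓘(ℂ, E) t) (x : M) :
    localExt E X x = (trivializationAt E (TangentSpace 𝓘(ℂ, E)) t).symm x (toModel t X) := by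
  have h1 : (trivializationAt E (TangentSpace 𝓘(ℂ, E)) t ⟨t, X⟩).2 = toModel t X :=
    (tangentBundleCore 𝓘(ℂ, E) M).coordChange_self (achart E t) t (mem_chart_source E t) X
  rw [localExt, h1]

theorem delBar_self {f : M → G} {t : M}
    (hf : DifferentiableAt ℝ (f ∘ (chartAt E t).symm) (chartAt E t t))
    (X : TangentSpace 𝓘(ℂ, E) t) :
    delBar f t X =
      wirtinger Complex.I (toModel t X) (f ∘ (chartAt E t).symm) (chartAt E t t) := by
  have h1 : ∀ Z : TangentSpace 𝓘(ℂ, E) t, realDeriv f t Z =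
      fderiv ℝ (f ∘ (chartAt E t).symm) (chartAt E t t) (toModel t Z) := fun Z => by
    rw [← realDeriv_symm (mem_chart_source E t) hf, tangent_symm_toModel]
  rw [delBar, wirtinger, h1, h1, map_smul]

end RealStructure

/-! ### The Chern connection in a holomorphic frame -/

open scoped Matrix Matrix.Norms.L2Operator

section MatrixCalculus

variable {ι : Type*} [Fintype ι] [DecidableEq ι] {E : Type*} [NormedAddCommGroup E]
  [NormedSpace ℂ E]

/-- The entries of a matrix, as a continuous linear equivalence. -/
noncomputable def matrixCLE : (ι → ι → ℂ) ≃L[ℂ] Matrix ι ι ℂ :=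
  (Matrix.ofLinearEquiv ℂ).toContinuousLinearEquiv

theorem contDiffAt_real_matrix {n : ℕ∞ω} {A : E → Matrix ι ι ℂ} {y : E}
    (hA : ∀ i j, ContDiffAt ℝ n (fun z => A z i j) y) : ContDiffAt ℝ n A y := by
  have h1 : ContDiffAt ℝ n (fun z => (fun i j => A z i j : ι → ι → ℂ)) y :=
    contDiffAt_pi.mpr fun i => contDiffAt_pi.mpr fun j => hA i j
  exact (((matrixCLE : (ι → ι → ℂ) ≃L[ℂ] Matrix ι ι ℂ) :
    (ι → ι → ℂ) →L[ℂ] Matrix ι ι ℂ).restrictScalars ℝ).contDiff.contDiffAt.comp y h1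

theorem contDiffAt_complex_matrix {n : ℕ∞ω} {A : E → Matrix ι ι ℂ} {y : E}
    (hA : ∀ i j, ContDiffAt ℂ n (fun z => A z i j) y) : ContDiffAt ℂ n A y := by
  have h1 : ContDiffAt ℂ n (fun z => (fun i j => A z i j : ι → ι → ℂ)) y :=
    contDiffAt_pi.mpr fun i => contDiffAt_pi.mpr fun j => hA i j
  exact ((matrixCLE : (ι → ι → ℂ) ≃L[ℂ] Matrix ι ι ℂ) :
    (ι → ι → ℂ) →L[ℂ] Matrix ι ι ℂ).contDiff.contDiffAt.comp y h1

end MatrixCalculus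

section ChernConnection

variable {E : Type*} [NormedAddCommGroup E] [NormedSpace ℂ E]
  {M : Type*} [TopologicalSpace M] [ChartedSpace E M]
  (F : Type*) [NormedAddCommGroup F] [NormedSpace ℂ F]
  {V : M → Type*} [TopologicalSpace (TotalSpace F V)]
  [∀ x, AddCommGroup (V x)] [∀ x, Module ℂ (V x)] [∀ x, TopologicalSpace (V x)]
  [FiberBundle F V]

variable {F} in
theorem localExt_self {t : M} (v : V t) : localExt F v t = v :=
  (trivializationAt F V t).symm_apply_apply_mk (FiberBundle.mem_baseSet_trivializationAt' t) v

variable [FiniteDimensional ℂ F] [VectorBundle ℂ F V]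

/-- The basis of a fibre near `t` given by the preferred trivialization at `t`. -/
noncomputable def frameBasis (t : M) {x : M} (hx : x ∈ (trivializationAt F V t).baseSet) :
    Module.Basis (Fin (Module.finrank ℂ F)) ℂ (V x) :=
  (trivializationAt F V t).basisAt (Module.finBasis ℂ F) hx

/-- The holomorphic frame near `t` given by the preferred trivialization at `t`. -/
noncomputable def frame (t : M) (i : Fin (Module.finrank ℂ F)) (x : M) : V x :=
  (trivializationAt F V t).symm x (Module.finBasis ℂ F i)

/-- The coordinates of a vector in the frame at `t`. -/
noncomputable def frameCoord (t : M) {x : M} (v : V x) : Fin (Module.finrank ℂ F) → ℂ :=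
  (Module.finBasis ℂ F).equivFun (trivializationAt F V t ⟨x, v⟩).2

variable {F}

theorem frameBasis_apply {t x : M} (hx : x ∈ (trivializationAt F V t).baseSet)
    (i : Fin (Module.finrank ℂ F)) : frameBasis F t hx i = frame F t i x := by
  simp [frameBasis, frame, Trivialization.basisAt]

theorem frameBasis_equivFun {t x : M} (hx : x ∈ (trivializationAt F V t).baseSet) (v : V x) :
    (frameBasis F t hx).equivFun v = frameCoord F t v := by
  ext i
  simp [frameBasis, frameCoord, Trivialization.basisAt]

theorem frameCoord_symm {t x : M} (hx : x ∈ (trivializationAt F V t).baseSet) (u : F) :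
    frameCoord F t ((trivializationAt F V t).symm x u) = (Module.finBasis ℂ F).equivFun u := by
  rw [frameCoord, Trivialization.apply_mk_symm _ hx]

theorem frameCoord_localExt {t x : M} (hx : x ∈ (trivializationAt F V t).baseSet) (v : V t) :
    frameCoord F t (localExt F v x) = frameCoord F t v := by
  rw [localExt, frameCoord_symm hx, frameCoord]

/-- The Gram matrix of a hermitian metric in the frame at `t`, as a function in the chart
at `t`. -/
noncomputable def gramChart (h : ∀ x, V x → V x → ℂ) (t : M) (y : E) :
    Matrix (Fin (Module.finrank ℂ F)) (Fin (Module.finrank ℂ F)) ℂ :=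
  gram (h ((chartAt E t).symm y)) fun i => frame F t i ((chartAt E t).symm y)

variable (F) in
/-- A hermitian metric of class `C²` at `t`. -/
def IsC2Metric (h : ∀ x, V x → V x → ℂ) (t : M) : Prop :=
  ∀ i j, ContMDiffAt 𝓘(ℝ, E) 𝓘(ℝ, ℂ) 2 (fun x => h x (frame F t i x) (frame F t j x)) t

theorem gramChart_chartAt (h : ∀ x, V x → V x → ℂ) {t x : M} (hx : x ∈ (chartAt E t).source)
    (hx' : x ∈ (trivializationAt F V t).baseSet) :
    gramChart (F := F) h t (chartAt E t x) = gram (h x) (frameBasis F t hx') := by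
  ext i j
  simp only [gramChart, gram, Matrix.of_apply, frameBasis_apply]
  rw [(chartAt E t).left_inv hx]

variable {h : ∀ x, V x → V x → ℂ} {t : M}

theorem eventually_chart {p : M → Prop} (hp : ∀ᶠ x in 𝓝 t, p x) :
    ∀ᶠ y in 𝓝 (chartAt E t t), p ((chartAt E t).symm y) := by
  have h1 := (chartAt E t).continuousAt_symm (mem_chart_target E t)
  refine h1.eventually ?_
  rwa [(chartAt E t).left_inv (mem_chart_source E t)]

theorem eventually_of_chart {p : E → Prop} (hp : ∀ᶠ y in 𝓝 (chartAt E t t), p y) :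
    ∀ᶠ x in 𝓝 t, p (chartAt E t x) :=
  ((chartAt E t).continuousAt (mem_chart_source E t)).eventually hp

theorem eventually_mem_baseSet : ∀ᶠ x in 𝓝 t, x ∈ (trivializationAt F V t).baseSet :=
  (trivializationAt F V t).open_baseSet.mem_nhds (FiberBundle.mem_baseSet_trivializationAt' t)

theorem isMetricNear_gramChart (hh : ∀ x, IsPosDefHermitian (h x))
    (hC : IsC2Metric (E := E) F h t) :
    IsMetricNear (gramChart (E := E) (F := F) h t) (fun y => (gramChart h t y)⁻¹)
      (chartAt E t t) := by
  have h1 : ContDiffAt ℝ 2 (gramChart (E := E) (F := F) h t) (chartAt E t t) := by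
    refine contDiffAt_real_matrix fun j i => ?_
    exact (contMDiffAt_real_iff.mp (hC i j)).2
  have h2 : ∀ᶠ y in 𝓝 (chartAt E t t), IsUnit (gramChart (E := E) (F := F) h t y) := by
    filter_upwards [eventually_chart (eventually_mem_baseSet (F := F) (V := V)
      (t := t))] with y hy
    have h3 := (hh _).isUnit_gram (frameBasis F t hy)
    rw [funext (frameBasis_apply hy)] at h3
    exact h3
  refine ⟨h1, ?_, ?_, ?_, ?_⟩
  · obtain ⟨u, hu⟩ := h2.self_of_nhds
    have h4 : ContDiffAt ℝ 2 Ring.inverse (gramChart (E := E) (F := F) h t (chartAt E t t)) := by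
      rw [← hu]
      exact contDiffAt_ringInverse ℝ u
    have h5 := h4.comp _ h1
    refine h5.congr_of_eventuallyEq (Filter.Eventually.of_forall fun y => ?_)
    exact Matrix.nonsing_inv_eq_ringInverse _
  · filter_upwards [h2] with y hy
    exact Matrix.mul_nonsing_inv _ ((Matrix.isUnit_iff_isUnit_det _).mp hy)
  · filter_upwards [h2] with y hy
    exact Matrix.nonsing_inv_mul _ ((Matrix.isUnit_iff_isUnit_det _).mp hy)
  · exact Filter.Eventually.of_forall fun y => (hh _).gram_conjTranspose _

variable [IsManifold 𝓘(ℂ, E) ω M] [ContMDiffVectorBundle ω F V 𝓘(ℂ, E)]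

theorem isHolAt_symm {x : M} (hx : x ∈ (trivializationAt F V t).baseSet) (u : F) :
    IsHolAt (E := E) F (fun x => (trivializationAt F V t).symm x u : ∀ x, V x) x := by
  rw [IsHolAt, (trivializationAt F V t).contMDiffAt_section_iff hx]
  refine (contMDiffAt_const (c := u)).congr_of_eventuallyEq ?_
  filter_upwards [(trivializationAt F V t).open_baseSet.mem_nhds hx] with z hz
  rw [Trivialization.apply_mk_symm _ hz]

theorem isHolAt_frame {x : M} (hx : x ∈ (trivializationAt F V t).baseSet)
    (i : Fin (Module.finrank ℂ F)) : IsHolAt (E := E) F (frame F t i : ∀ x, V x) x :=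
  isHolAt_symm hx _

theorem contMDiffAt_frameCoord {s : ∀ x, V x} {x : M}
    (hx : x ∈ (trivializationAt F V t).baseSet) (hs : IsHolAt (E := E) F s x)
    (i : Fin (Module.finrank ℂ F)) :
    ContMDiffAt 𝓘(ℂ, E) 𝓘(ℂ, ℂ) ω (fun x => frameCoord F t (s x) i) x := by
  rw [IsHolAt, (trivializationAt F V t).contMDiffAt_section_iff hx] at hs
  let l : F →L[ℂ] ℂ := LinearMap.toContinuousLinearMap
    ((LinearMap.proj i).comp (Module.finBasis ℂ F).equivFun.toLinearMap)
  exact l.contDiff.contMDiff.contMDiffAt.comp x hs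

/-- The coordinates of a section which is holomorphic at `x` are holomorphic in the chart at a
nearby point `t`. -/
theorem differentiableAt_frameCoord {s : ∀ x, V x} {x : M} (hxc : x ∈ (chartAt E t).source)
    (hx : x ∈ (trivializationAt F V t).baseSet) (hs : IsHolAt (E := E) F s x)
    (i : Fin (Module.finrank ℂ F)) :
    DifferentiableAt ℂ ((fun x => frameCoord F t (s x) i) ∘ (chartAt E t).symm)
      (chartAt E t x) := by
  have h1 := (contMDiffAt_frameCoord hx hs i).mdifferentiableAt (by simp)
  have : IsManifold 𝓘(ℂ, E) 1 M := .of_le (n := ω) le_top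
  rw [mdifferentiableAt_iff_source_of_mem_source hxc] at h1
  simpa [mfld_simps, mdifferentiableWithinAt_univ, mdifferentiableAt_iff_differentiableAt]
    using h1

/-- `D_X s` is characterized by its defining equation. -/
theorem chernD_eq (hh : ∀ x, IsPosDefHermitian (h x)) {s : ∀ x, V x} {x : M}
    {X : TangentSpace 𝓘(ℂ, E) x} {w : V x}
    (hw : ∀ s' : ∀ x, V x, IsHolAt (E := E) F s' x →
      h x w (s' x) = del (fun x => h x (s x) (s' x)) x X) :
    chernD F h s x X = w := by
  have h1 := Classical.epsilon_spec (p := fun w : V x => ∀ s' : ∀ x, V x,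
    IsHolAt (E := E) F s' x → h x w (s' x) = del (fun x => h x (s x) (s' x)) x X) ⟨w, hw⟩
  have hx := FiberBundle.mem_baseSet_trivializationAt' (F := F) (E := V) x
  refine (hh x).ext_basis (frameBasis F x hx) fun i => ?_
  rw [frameBasis_apply, chernD, h1 _ (isHolAt_frame hx i), hw _ (isHolAt_frame hx i)]

end ChernConnection

/-- Evaluation of a coordinate of `N *ᵥ c`, as a continuous linear functional of the matrix `N`. -/
noncomputable def mulVecCLM {ι : Type*} [Fintype ι] [DecidableEq ι] (c : ι → ℂ) (j : ι) :
    Matrix ι ι ℂ →L[ℂ] ℂ :=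
  LinearMap.toContinuousLinearMap
    { toFun := fun N => (N *ᵥ c) j
      map_add' := fun N N' => by rw [Matrix.add_mulVec, Pi.add_apply]
      map_smul' := fun a N => by rw [Matrix.smul_mulVec, Pi.smul_apply, RingHom.id_apply] }

theorem mulVecCLM_apply {ι : Type*} [Fintype ι] [DecidableEq ι] (c : ι → ℂ) (j : ι)
    (N : Matrix ι ι ℂ) : mulVecCLM c j N = (N *ᵥ c) j := rfl

section ChernFormulas

variable {E : Type*} [NormedAddCommGroup E] [NormedSpace ℂ E]
  {M : Type*} [TopologicalSpace M] [ChartedSpace E M]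
  {F : Type*} [NormedAddCommGroup F] [NormedSpace ℂ F] [FiniteDimensional ℂ F]
  {V : M → Type*} [TopologicalSpace (TotalSpace F V)]
  [∀ x, AddCommGroup (V x)] [∀ x, Module ℂ (V x)] [∀ x, TopologicalSpace (V x)]
  [FiberBundle F V] [VectorBundle ℂ F V]
  {h : ∀ x, V x → V x → ℂ} {t : M}
  [IsManifold 𝓘(ℂ, E) ω M] [ContMDiffVectorBundle ω F V 𝓘(ℂ, E)]

/-- The connection form of the Chern connection, in the chart and the frame at `t`. -/
noncomputable def chernForm (h : ∀ x, V x → V x → ℂ) (t : M) (X : E) (y : E) :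
    Matrix (Fin (Module.finrank ℂ F)) (Fin (Module.finrank ℂ F)) ℂ :=
  connForm (gramChart (F := F) h t) (fun y => (gramChart (F := F) h t y)⁻¹) X y

/-- The vector with coordinates `Γ c` satisfies the equation that defines `D_X` of the section
with constant coordinates `c`. -/
theorem metric_chernForm_apply (hh : ∀ x, IsPosDefHermitian (h x)) {x : M}
    (hxc : x ∈ (chartAt E t).source) (hx : x ∈ (trivializationAt F V t).baseSet)
    (hN : IsMetricNear (gramChart (F := F) h t) (fun y => (gramChart h t y)⁻¹) (chartAt E t x))
    (v : V t) (X : TangentSpace 𝓘(ℂ, E) t) {s' : ∀ x, V x} (hs' : IsHolAt (E := E) F s' x) :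
    h x ((frameBasis F t hx).equivFun.symm
      (chernForm h t (toModel t X) (chartAt E t x) *ᵥ frameCoord F t v)) (s' x) =
      del (fun x => h x (localExt F v x) (s' x)) x (localExt E X x) := by
  set c := frameCoord F t v with hc
  set σ : Fin (Module.finrank ℂ F) → E → ℂ :=
    fun j => (fun x => frameCoord F t (s' x) j) ∘ (chartAt E t).symm with hσ
  have hσd : ∀ j, DifferentiableAt ℂ (σ j) (chartAt E t x) :=
    differentiableAt_frameCoord hxc hx hs'
  have hσs : ∀ j, DifferentiableAt ℝ (fun z => star (σ j z)) (chartAt E t x) := fun j =>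
    ((hσd j).restrictScalars ℝ).star
  have hℓ : ∀ j, DifferentiableAt ℝ
      (fun z => mulVecCLM c j (gramChart (F := F) h t z)) (chartAt E t x) := fun j =>
    ((mulVecCLM c j).restrictScalars ℝ).differentiableAt.comp _ hN.diff
  have hev : (fun x => h x (localExt F v x) (s' x)) ∘ (chartAt E t).symm =ᶠ[𝓝 (chartAt E t x)]
      fun z => ∑ j, star (σ j z) * mulVecCLM c j (gramChart (F := F) h t z) := by
    have h1 : ∀ᶠ z in 𝓝 (chartAt E t x), (chartAt E t).symm z ∈
        (trivializationAt F V t).baseSet := by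
      refine ((chartAt E t).continuousAt_symm ((chartAt E t).map_source hxc)).eventually ?_
      rw [(chartAt E t).left_inv hxc]
      exact (trivializationAt F V t).open_baseSet.mem_nhds hx
    filter_upwards [h1] with z hz
    rw [Function.comp_apply, (hh _).eq_gram (frameBasis F t hz), frameBasis_equivFun,
      frameBasis_equivFun, frameCoord_localExt hz, funext (frameBasis_apply hz)]
    rfl
  have hdiff : DifferentiableAt ℝ
      (fun z => ∑ j, star (σ j z) * mulVecCLM c j (gramChart (F := F) h t z))
      (chartAt E t x) :=
    DifferentiableAt.fun_sum fun j _ => (hσs j).fun_mul (hℓ j)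
  rw [tangent_localExt, del_symm hxc (hdiff.congr_of_eventuallyEq hev), wirtinger_congr _ _ hev,
    wirtinger_sum _ _ _ fun j _ => (hσs j).fun_mul (hℓ j), (hh x).eq_gram (frameBasis F t hx),
    LinearEquiv.apply_symm_apply, frameBasis_equivFun, ← gramChart_chartAt h hxc hx,
    Matrix.mulVec_mulVec, chernForm, hN.mul_connForm]
  refine Finset.sum_congr rfl fun j _ => ?_
  rw [wirtinger_mul _ _ (hσs j) (hℓ j), wirtinger_star, map_neg, Complex.conj_I, neg_neg,
    wirtingerBar_of_differentiableAt _ (hσd j), star_zero, zero_mul, zero_add,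
    wirtinger_clm _ _ _ hN.diff, mulVecCLM_apply, Pi.star_apply]
  exact congrArg (fun z => star (frameCoord F t (s' z) j) * _) ((chartAt E t).left_inv hxc).symm

theorem chernD_localExt (hh : ∀ x, IsPosDefHermitian (h x)) {x : M}
    (hxc : x ∈ (chartAt E t).source) (hx : x ∈ (trivializationAt F V t).baseSet)
    (hN : IsMetricNear (gramChart (F := F) h t) (fun y => (gramChart h t y)⁻¹) (chartAt E t x))
    (v : V t) (X : TangentSpace 𝓘(ℂ, E) t) :
    chernD F h (localExt F v) x (localExt E X x) = (frameBasis F t hx).equivFun.symm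
      (chernForm h t (toModel t X) (chartAt E t x) *ᵥ frameCoord F t v) :=
  chernD_eq hh fun _ hs' => metric_chernForm_apply hh hxc hx hN v X hs'

theorem frameCoord_chernD (hh : ∀ x, IsPosDefHermitian (h x)) {x : M}
    (hxc : x ∈ (chartAt E t).source) (hx : x ∈ (trivializationAt F V t).baseSet)
    (hN : IsMetricNear (gramChart (F := F) h t) (fun y => (gramChart h t y)⁻¹) (chartAt E t x))
    (v : V t) (X : TangentSpace 𝓘(ℂ, E) t) :
    frameCoord F t (chernD F h (localExt F v) x (localExt E X x)) =
      chernForm h t (toModel t X) (chartAt E t x) *ᵥ frameCoord F t v := by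
  rw [chernD_localExt hh hxc hx hN, ← frameBasis_equivFun hx, LinearEquiv.apply_symm_apply]

/-- The defining equation of the Chern connection holds: the choice in `chernD` is not a junk
value. -/
theorem metric_chernD (hh : ∀ x, IsPosDefHermitian (h x)) (hC : IsC2Metric (E := E) F h t)
    (v : V t) (X : TangentSpace 𝓘(ℂ, E) t) {s' : ∀ x, V x} (hs' : IsHolAt (E := E) F s' t) :
    h t (chernD F h (localExt F v) t X) (s' t) =
      del (fun x => h x (localExt F v x) (s' x)) t X := by
  have hN := isMetricNear_gramChart hh hC
  have hb := FiberBundle.mem_baseSet_trivializationAt' (F := F) (E := V) t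
  have h1 := chernD_localExt hh (mem_chart_source E t) hb hN v X
  have h2 := metric_chernForm_apply hh (mem_chart_source E t) hb hN v X hs'
  rw [← h1, localExt_self] at h2
  exact h2

/-- Holomorphic sections are killed by the Cauchy-Riemann operator. -/
theorem dbar_eq_zero_of_isHolAt {s : ∀ x, V x} {x : M} (hs : IsHolAt (E := E) F s x)
    (X : TangentSpace 𝓘(ℂ, E) x) : dbar F s x X = 0 := by
  have h1 : ContMDiffAt 𝓘(ℂ, E) 𝓘(ℂ, F) ω
      (fun z => (trivializationAt F V x ⟨z, s z⟩).2) x := (contMDiffAt_section x).mp hs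
  have h2 := (h1.mdifferentiableAt (by simp)).hasMFDerivAt
  have h3 := (hasMFDerivAt_real_of_complex h2).mfderiv
  have h4 : delBar (fun z => (trivializationAt F V x ⟨z, s z⟩).2) x X = 0 := by
    have h5 : ∀ Z : TangentSpace 𝓘(ℂ, E) x,
        realDeriv (fun z => (trivializationAt F V x ⟨z, s z⟩).2) x Z =
          (mfderiv 𝓘(ℂ, E) 𝓘(ℂ, F) (fun z => (trivializationAt F V x ⟨z, s z⟩).2) x :
            E →L[ℂ] F) Z := fun Z => by
      unfold realDeriv
      rw [h3]
      rfl
    have h6 := (mfderiv 𝓘(ℂ, E) 𝓘(ℂ, F) (fun z => (trivializationAt F V x ⟨z, s z⟩).2) x :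
            E →L[ℂ] F).map_smul Complex.I X
    have h7 : ∀ a b : F, b = Complex.I • a → (1 / 2 : ℂ) • (a + Complex.I • b) = 0 := by
      rintro a b rfl
      rw [smul_smul, Complex.I_mul_I, neg_one_smul, add_neg_cancel, smul_zero]
    refine h7 _ _ ?_
    rw [h5, h5]
    exact h6
  rw [dbar, h4, ← Trivialization.symmL_apply (R := ℂ) _
    (FiberBundle.mem_baseSet_trivializationAt' x), map_zero]

theorem del_congr {G : Type*} [NormedAddCommGroup G] [NormedSpace ℂ G] {f g : M → G} {x : M}
    (hfg : f =ᶠ[𝓝 x] g) (X : TangentSpace 𝓘(ℂ, E) x) : del f x X = del g x X := by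
  unfold del realDeriv
  rw [hfg.mfderiv_eq]
  rfl

theorem delBar_congr {G : Type*} [NormedAddCommGroup G] [NormedSpace ℂ G] {f g : M → G} {x : M}
    (hfg : f =ᶠ[𝓝 x] g) (X : TangentSpace 𝓘(ℂ, E) x) : delBar f x X = delBar g x X := by
  unfold delBar realDeriv
  rw [hfg.mfderiv_eq]
  rfl

theorem chernD_eq_zero (hh : ∀ x, IsPosDefHermitian (h x)) {s : ∀ x, V x} {x : M}
    (hs : ∀ᶠ z in 𝓝 x, s z = 0) (X : TangentSpace 𝓘(ℂ, E) x) : chernD F h s x X = 0 := by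
  refine chernD_eq hh fun s' _ => ?_
  have h1 : (fun z => h z (s z) (s' z)) =ᶠ[𝓝 x] fun _ => (0 : ℂ) := by
    filter_upwards [hs] with z hz
    rw [hz, (hh z).zero_left]
  rw [(hh x).zero_left, del_congr h1]
  have h2 : ∀ Z : TangentSpace 𝓘(ℂ, E) x, realDeriv (fun _ : M => (0 : ℂ)) x Z = 0 := fun Z => by
    unfold realDeriv
    rw [mfderiv_const]
    rfl
  rw [del, h2, h2, smul_zero, sub_zero, smul_zero]

/-- The curvature of the Chern connection is `-∂bar Γ`. -/
theorem frameCoord_chernCurvature (hh : ∀ x, IsPosDefHermitian (h x))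
    (hC : IsC2Metric (E := E) F h t) (X Y : TangentSpace 𝓘(ℂ, E) t) (v : V t) :
    frameCoord F t (chernCurvature F h X Y v) =
      -(wirtinger Complex.I (toModel t Y) (chernForm h t (toModel t X)) (chartAt E t t) *ᵥ
        frameCoord F t v) := by
  have hN := isMetricNear_gramChart hh hC
  have hb := FiberBundle.mem_baseSet_trivializationAt' (F := F) (E := V) t
  have hs1 : chernD F h (fun x => dbar F (localExt F v) x (localExt E Y x)) t X = 0 := by
    refine chernD_eq_zero hh ?_ X
    filter_upwards [eventually_mem_baseSet (F := F) (V := V) (t := t)] with x hx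
    exact dbar_eq_zero_of_isHolAt (isHolAt_symm hx _) _
  set c := frameCoord F t v with hc
  let L : Matrix (Fin (Module.finrank ℂ F)) (Fin (Module.finrank ℂ F)) ℂ →L[ℂ] F :=
    LinearMap.toContinuousLinearMap
      { toFun := fun N => (Module.finBasis ℂ F).equivFun.symm (N *ᵥ c)
        map_add' := fun N N' => by rw [Matrix.add_mulVec, map_add]
        map_smul' := fun a N => by rw [Matrix.smul_mulVec, map_smul, RingHom.id_apply] }
  have hL : ∀ N, (Module.finBasis ℂ F).equivFun (L N) = N *ᵥ c := fun N =>
    (Module.finBasis ℂ F).equivFun.apply_symm_apply _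
  have hev : (fun x => (trivializationAt F V t
      ⟨x, chernD F h (localExt F v) x (localExt E X x)⟩).2) =ᶠ[𝓝 t]
      fun x => L (chernForm h t (toModel t X) (chartAt E t x)) := by
    filter_upwards [eventually_mem_baseSet (F := F) (V := V) (t := t),
      (chartAt E t).open_source.mem_nhds (mem_chart_source E t),
      eventually_of_chart hN.eventually] with x hx hxc hNx
    have h1 := frameCoord_chernD hh hxc hx hNx v X
    rw [← hc, ← hL] at h1
    exact (Module.finBasis ℂ F).equivFun.injective h1
  have hd : DifferentiableAt ℝ (chernForm (F := F) h t (toModel t X)) (chartAt E t t) :=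
    hN.differentiableAt_connForm (toModel t X)
  have hLd : DifferentiableAt ℝ (fun y => L (chernForm (F := F) h t (toModel t X) y))
      (chartAt E t t) :=
    (L.restrictScalars ℝ).differentiableAt.comp _ hd
  have hev2 : (fun x => L (chernForm (F := F) h t (toModel t X) (chartAt E t x))) ∘
      (chartAt E t).symm =ᶠ[𝓝 (chartAt E t t)] fun y => L (chernForm h t (toModel t X) y) := by
    filter_upwards [(chartAt E t).open_target.mem_nhds (mem_chart_target E t)] with y hy
    rw [Function.comp_apply, (chartAt E t).right_inv hy]
  rw [chernCurvature, hs1, zero_sub, dbar, delBar_congr hev,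
    delBar_self (hLd.congr_of_eventuallyEq hev2), wirtinger_congr _ _ hev2,
    wirtinger_clm _ _ L hd, ← frameBasis_equivFun hb, map_neg, frameBasis_equivFun,
    frameCoord_symm hb, hL]

/-- The curvature of the Chern connection on the diagonal, through second derivatives of the
metric. -/
theorem metric_chernCurvature_self (hh : ∀ x, IsPosDefHermitian (h x))
    (hC : IsC2Metric (E := E) F h t) (X : TangentSpace 𝓘(ℂ, E) t) (v : V t) :
    h t (chernCurvature F h X X v) v =
      h t (chernD F h (localExt F v) t X) (chernD F h (localExt F v) t X) -
        wirtinger Complex.I (toModel t X) (wirtinger (-Complex.I) (toModel t X)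
          ((fun x => h x (localExt F v x) (localExt F v x)) ∘ (chartAt E t).symm))
          (chartAt E t t) := by
  have hN := isMetricNear_gramChart hh hC
  have hb := FiberBundle.mem_baseSet_trivializationAt' (F := F) (E := V) t
  have hw := frameCoord_chernD hh (mem_chart_source E t) hb hN v X
  rw [localExt_self] at hw
  set c := frameCoord F t v with hc
  let L : Matrix (Fin (Module.finrank ℂ F)) (Fin (Module.finrank ℂ F)) ℂ →L[ℂ] ℂ :=
    ∑ j, star (c j) • mulVecCLM c j
  have hL : ∀ N, L N = star c ⬝ᵥ (N *ᵥ c) := fun N => by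
    simp [L, mulVecCLM_apply, dotProduct]
  have hev : ∀ᶠ y in 𝓝 (chartAt E t t),
      ((fun x => h x (localExt F v x) (localExt F v x)) ∘ (chartAt E t).symm) y =
        L (gramChart h t y) := by
    filter_upwards [eventually_chart (eventually_mem_baseSet (F := F) (V := V) (t := t))]
      with z hz
    rw [Function.comp_apply, (hh _).eq_gram (frameBasis F t hz), frameBasis_equivFun,
      frameCoord_localExt hz, funext (frameBasis_apply hz), hL]
    rfl
  have hev' : wirtinger (-Complex.I) (toModel t X)
      ((fun x => h x (localExt F v x) (localExt F v x)) ∘ (chartAt E t).symm)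
      =ᶠ[𝓝 (chartAt E t t)] fun y =>
        L (wirtinger (-Complex.I) (toModel t X) (gramChart h t) y) := by
    filter_upwards [hev.eventually_nhds, hN.eventually] with y hy hNy
    rw [wirtinger_congr _ _ hy, wirtinger_clm _ _ L hNy.diff]
  have key := hN.mul_wirtingerBar_connForm (toModel t X)
  rw [wirtinger_congr _ _ hev',
    wirtinger_clm _ _ L (differentiableAt_wirtinger _ _ hN.contDiffAt),
    (hh t).eq_gram (frameBasis F t hb), (hh t).eq_gram (frameBasis F t hb),
    ← gramChart_chartAt h (mem_chart_source E t) hb, frameBasis_equivFun, frameBasis_equivFun,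
    frameBasis_equivFun, frameCoord_chernCurvature hh hC]
  rw [hw, ← hc, Matrix.mulVec_neg, Matrix.mulVec_mulVec]
  unfold chernForm
  rw [key, hL, Matrix.sub_mulVec, dotProduct_neg, dotProduct_sub, Matrix.star_mulVec,
    ← Matrix.dotProduct_mulVec, Matrix.mulVec_mulVec, Matrix.mulVec_mulVec, neg_sub]
  rfl

end ChernFormulas

/-! ### The hermitian forms of a CV⊕-structure -/

section CVForms

variable {E : Type*} [NormedAddCommGroup E] [NormedSpace ℂ E] [FiniteDimensional ℂ E]
  {M : Type*} [TopologicalSpace M] [ChartedSpace E M] [IsManifold 𝓘(ℂ, E) ω M]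
  {F : Type*} [NormedAddCommGroup F] [NormedSpace ℂ F] [FiniteDimensional ℂ F]
  {K : M → Type*} [TopologicalSpace (TotalSpace F K)]
  [∀ x, AddCommGroup (K x)] [∀ x, Module ℂ (K x)] [∀ x, TopologicalSpace (K x)]
  [FiberBundle F K] [VectorBundle ℂ F K] [ContMDiffVectorBundle ω F K 𝓘(ℂ, E)]
  (S : CVStructure E F K)

namespace CVStructure

/-- The endomorphism `κ C_X κ`, which is the adjoint of `C_X` with respect to `h`. -/
noncomputable def adjC (t : M) (X : TangentSpace 𝓘(ℂ, E) t) : Module.End ℂ (K t) where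
  toFun a := S.κ t (S.C t X (S.κ t a))
  map_add' a b := by simp only [map_add]
  map_smul' c a := by simp only [map_smulₛₗ, Complex.conj_conj, RingHom.id_apply]

variable {S}

/-- The adjoint of `C_X` is `κ C_X κ`, as `C_X` is symmetric for `g`. -/
theorem h_C (hS : S.IsPositive) (t : M) (X : TangentSpace 𝓘(ℂ, E) t) (a b : K t) :
    S.h t a (S.C t X b) = S.h t (S.adjC t X a) b := by
  rw [(hS t).conj_symm, (hS t).conj_symm b, S.h_eq, S.h_eq, S.g_C]
  simp only [adjC, LinearMap.coe_mk, AddHom.coe_mk, S.κ_invol]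

theorem h_adjC (hS : S.IsPositive) (t : M) (X : TangentSpace 𝓘(ℂ, E) t) (a b : K t) :
    S.h t a (S.adjC t X b) = S.h t (S.C t X a) b := by
  rw [(hS t).conj_symm, ← h_C hS, ← (hS t).conj_symm]

variable (S) in
/-- The commutator `[C_X, κ C_X κ]` of `C_X` with its adjoint, which is minus the curvature
`R(X, X̄)` of `K` by the `tt*`-equation. -/
noncomputable def commC (t : M) (X : TangentSpace 𝓘(ℂ, E) t) : Module.End ℂ (K t) :=
  S.C t X * S.adjC t X - S.adjC t X * S.C t X

theorem h_commC (hS : S.IsPositive) (t : M) (X : TangentSpace 𝓘(ℂ, E) t) (a b : K t) :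
    S.h t a (S.commC t X b) = S.h t (S.commC t X a) b := by
  simp only [commC, LinearMap.sub_apply, Module.End.mul_apply, (hS t).sub_right,
    (hS t).sub_left, h_C hS, h_adjC hS]

theorem hEnd_isPosDef (hS : S.IsPositive) (t : M) : IsPosDefHermitian (S.hEnd t) :=
  (hS t).endForm _

theorem hM_eq_hEnd (hS : S.IsPositive) (t : M) (X Y : TangentSpace 𝓘(ℂ, E) t) :
    S.hM t X Y = S.hEnd t (S.C t X) (S.C t Y) := by
  have h1 : S.hM t X Y = S.hEnd t (-S.C t X) (-S.C t Y) := rfl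
  rw [h1, (hEnd_isPosDef hS t).neg_left, (hEnd_isPosDef hS t).neg_right, neg_neg]

theorem IsPrimitive.C_injective {ζ : ∀ x, K x} (hζ : S.IsPrimitive ζ) (t : M) :
    Function.Injective (S.C t) := fun X Y hXY =>
  (hζ.bij t).1 (by simp only [hXY])

theorem hF_isPosDef (hS : S.IsPositive) (t : M) : IsPosDefHermitian (S.hF t) where
  add_left _ _ _ := (hEnd_isPosDef hS t).add_left _ _ _
  smul_left _ _ _ := (hEnd_isPosDef hS t).smul_left _ _ _
  conj_symm _ _ := (hEnd_isPosDef hS t).conj_symm _ _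
  pos _ ha := (hEnd_isPosDef hS t).pos _ fun h0 => ha (Subtype.ext h0)

theorem hM_isPosDef (hS : S.IsPositive) {ζ : ∀ x, K x} (hζ : S.IsPrimitive ζ) (t : M) :
    IsPosDefHermitian (S.hM t) where
  add_left X Y Z := by
    simp only [hM_eq_hEnd hS, map_add, (hEnd_isPosDef hS t).add_left]
  smul_left c X Y := by
    simp only [hM_eq_hEnd hS, map_smul, (hEnd_isPosDef hS t).smul_left]
  conj_symm X Y := by
    rw [hM_eq_hEnd hS, hM_eq_hEnd hS, (hEnd_isPosDef hS t).conj_symm]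
  pos X hX := by
    rw [hM_eq_hEnd hS]
    refine (hEnd_isPosDef hS t).pos _ fun h0 => hX (hζ.C_injective t ?_)
    rw [h0, map_zero]

/-- The commutator term in the second derivative of `tr (C_X C_X*)` is `‖[C_X, C_X*]‖²`, by
cyclicity of the trace. -/
theorem hEnd_commC (hS : S.IsPositive) (t : M) (X : TangentSpace 𝓘(ℂ, E) t) :
    S.hEnd t (S.commC t X * S.C t X - S.C t X * S.commC t X) (S.C t X) =
      S.hEnd t (S.commC t X) (S.commC t X) := by
  have h1 := (hS t).endForm_eq_trace (fiberBasis F t)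
    (P := S.commC t X * S.C t X - S.C t X * S.commC t X) (h_C hS t X)
  have h2 := (hS t).endForm_eq_trace (fiberBasis F t) (P := S.commC t X) (h_commC hS t X)
  unfold hEnd
  rw [h1, h2]
  set P := S.commC t X with hP
  have h3 : S.commC t X * P = S.C t X * S.adjC t X * P - S.adjC t X * S.C t X * P := by
    rw [commC, sub_mul]
  rw [← hP] at h3
  rw [h3, mul_sub, map_sub, map_sub, ← mul_assoc, ← mul_assoc, LinearMap.trace_mul_comm,
    ← mul_assoc]

/-- In the frame at a nearby point `t`, the form `h^end` is `(A, B) ↦ tr (A H⁻¹ Bᴴ H)`. -/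
theorem hEnd_eq_trace (hS : S.IsPositive) {t x : M}
    (hx : x ∈ (trivializationAt F K t).baseSet) (A B : Module.End ℂ (K x)) :
    S.hEnd x A B = Matrix.trace
      (LinearMap.toMatrix (frameBasis F t hx) (frameBasis F t hx) A *
        (gram (S.h x) (frameBasis F t hx))⁻¹ *
        (LinearMap.toMatrix (frameBasis F t hx) (frameBasis F t hx) B)ᴴ *
        gram (S.h x) (frameBasis F t hx)) :=
  (hS x).endForm_eq_matrix _ _ _ _

/-! ### Smoothness of the metrics -/

theorem _root_.TTStar.IsHolAt.isSmoothAt {V : M → Type*} [TopologicalSpace (TotalSpace F V)]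
    [∀ x, AddCommGroup (V x)] [∀ x, Module ℂ (V x)] [∀ x, TopologicalSpace (V x)]
    [FiberBundle F V] {s : ∀ x, V x} {t : M} (hs : IsHolAt (E := E) F s t) :
    IsSmoothAt (E := E) F s t := by
  have h1 := contMDiffAt_real_of_complex ((contMDiffAt_section t).mp hs)
  exact (contMDiffAt_section t).mpr (h1.of_le le_top)

variable (S) in
/-- The metric `h = g(·, κ ·)` is `C²`, as `g` is holomorphic and `κ` is smooth. -/
theorem isC2Metric_h (t : M) : IsC2Metric (E := E) F S.h t := by
  intro i j
  have hb := FiberBundle.mem_baseSet_trivializationAt' (F := F) (E := K) t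
  have h1 := S.κ_smooth t _ (isHolAt_frame (E := E) hb j).isSmoothAt
  have h2 : ∀ k, ContMDiffAt 𝓘(ℝ, E) 𝓘(ℝ, ℂ) ∞
      (fun x => frameCoord F t (S.κ x (frame F t j x)) k) t := fun k => by
    let l : F →L[ℝ] ℂ := (LinearMap.toContinuousLinearMap
      ((LinearMap.proj k).comp (Module.finBasis ℂ F).equivFun.toLinearMap)).restrictScalars ℝ
    exact l.contDiff.contMDiff.contMDiffAt.comp t ((contMDiffAt_section t).mp h1)
  have h3 : ∀ k, ContMDiffAt 𝓘(ℝ, E) 𝓘(ℝ, ℂ) ω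
      (fun x => S.g x (frame F t i x) (frame F t k x)) t := fun k =>
    contMDiffAt_real_of_complex (S.g_hol t _ _ (isHolAt_frame hb i) (isHolAt_frame hb k))
  have h4 : ContMDiffAt 𝓘(ℝ, E) 𝓘(ℝ, ℂ) 2 (fun x => ∑ k,
      frameCoord F t (S.κ x (frame F t j x)) k * S.g x (frame F t i x) (frame F t k x)) t := by
    rw [contMDiffAt_real_iff]
    refine ⟨?_, ?_⟩
    · exact tendsto_finsetSum _ fun k _ => (h2 k).continuousAt.mul (h3 k).continuousAt
    · refine ContDiffAt.sum fun k _ => ContDiffAt.mul ?_ ?_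
      · exact (contMDiffAt_real_iff.mp (h2 k)).2.of_le (by norm_cast)
      · exact (contMDiffAt_real_iff.mp (h3 k)).2.of_le le_top
  refine h4.congr_of_eventuallyEq ?_
  filter_upwards [eventually_mem_baseSet (F := F) (V := K) (t := t)] with x hx
  have h5 := (frameBasis F t hx).sum_equivFun (S.κ x (frame F t j x))
  rw [frameBasis_equivFun] at h5
  rw [S.h_eq]
  conv_lhs => rw [← h5]
  simp [frameBasis_apply]

variable (S) in
/-- The matrix of `C_Z` in the frame and the chart at `t`, for a vector field `Z` which is
constant in that chart. -/
noncomputable def matC (t : M) (Z : E) (y : E) :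
    Matrix (Fin (Module.finrank ℂ F)) (Fin (Module.finrank ℂ F)) ℂ :=
  Matrix.of fun i j => frameCoord F t (S.C ((chartAt E t).symm y)
    ((trivializationAt E (TangentSpace 𝓘(ℂ, E)) t).symm ((chartAt E t).symm y) Z)
    (frame F t j ((chartAt E t).symm y))) i

theorem matC_chartAt {t x : M} (hxc : x ∈ (chartAt E t).source)
    (hx : x ∈ (trivializationAt F K t).baseSet) (Z : E) :
    S.matC t Z (chartAt E t x) = LinearMap.toMatrix (frameBasis F t hx) (frameBasis F t hx)
      (S.C x ((trivializationAt E (TangentSpace 𝓘(ℂ, E)) t).symm x Z)) := by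
  ext i j
  rw [LinearMap.toMatrix_apply, frameBasis_apply, ← Module.Basis.equivFun_apply,
    frameBasis_equivFun, matC, Matrix.of_apply]
  exact congrArg (fun z => frameCoord F t (S.C z
    ((trivializationAt E (TangentSpace 𝓘(ℂ, E)) t).symm z Z) (frame F t j z)) i)
    ((chartAt E t).left_inv hxc)

variable (S) in
theorem contDiffAt_matC (t : M) (Z : E) : ContDiffAt ℂ ω (S.matC t Z) (chartAt E t t) := by
  have hb := FiberBundle.mem_baseSet_trivializationAt' (F := F) (E := K) t
  refine contDiffAt_complex_matrix fun i j => ?_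
  have h1 := S.C_hol t (fun x => (trivializationAt E (TangentSpace 𝓘(ℂ, E)) t).symm x Z)
    (frame F t j) (isHolAt_symm (mem_chart_source E t) Z) (isHolAt_frame hb j)
  exact (contMDiffAt_complex_iff.mp (contMDiffAt_frameCoord hb h1 i)).2

variable (S) in
/-- The metric `h^M` on constant vector fields, in the chart at `t`. -/
noncomputable def formC (t : M) (Z W : E) (y : E) : ℂ :=
  Matrix.trace (S.matC t Z y * (gramChart (F := F) S.h t y)⁻¹ * star (S.matC t W y) *
    gramChart S.h t y)

theorem hM_eq_formC (hS : S.IsPositive) {t x : M} (hxc : x ∈ (chartAt E t).source)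
    (hx : x ∈ (trivializationAt F K t).baseSet) (Z W : E) :
    S.hM x ((trivializationAt E (TangentSpace 𝓘(ℂ, E)) t).symm x Z)
      ((trivializationAt E (TangentSpace 𝓘(ℂ, E)) t).symm x W) =
      S.formC t Z W (chartAt E t x) := by
  rw [hM_eq_hEnd hS, hEnd_eq_trace hS hx, formC, matC_chartAt hxc hx, matC_chartAt hxc hx,
    gramChart_chartAt _ hxc hx]
  rfl

variable (F) in
/-- The trace of matrices as a continuous linear functional. -/
noncomputable def traceCLM :
    Matrix (Fin (Module.finrank ℂ F)) (Fin (Module.finrank ℂ F)) ℂ →L[ℂ] ℂ :=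
  LinearMap.toContinuousLinearMap (Matrix.traceLinearMap _ ℂ ℂ)

theorem isMetricNear_h (hS : S.IsPositive) (t : M) :
    IsMetricNear (gramChart (E := E) (F := F) S.h t) (fun y => (gramChart S.h t y)⁻¹)
      (chartAt E t t) :=
  isMetricNear_gramChart hS (S.isC2Metric_h t)

theorem contDiffAt_formC (hS : S.IsPositive) (t : M) (Z W : E) :
    ContDiffAt ℝ 2 (S.formC t Z W) (chartAt E t t) := by
  have hN := isMetricNear_h hS t
  have h1 : ∀ Z, ContDiffAt ℝ 2 (S.matC t Z) (chartAt E t t) := fun Z =>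
    ((S.contDiffAt_matC t Z).restrict_scalars ℝ).of_le le_top
  have h2 : ContDiffAt ℝ 2 (fun y => star (S.matC t W y)) (chartAt E t t) :=
    (starL' ℝ : Matrix (Fin (Module.finrank ℂ F)) (Fin (Module.finrank ℂ F)) ℂ ≃L[ℝ]
      Matrix (Fin (Module.finrank ℂ F)) (Fin (Module.finrank ℂ F)) ℂ).contDiff.contDiffAt.comp _
        (h1 W)
  exact ((traceCLM F).restrictScalars ℝ).contDiff.contDiffAt.comp _
    ((((h1 Z).mul hN.contDiffAt_inv).mul h2).mul hN.contDiffAt)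

theorem isC2Metric_hM (hS : S.IsPositive) (t : M) : IsC2Metric (E := E) E S.hM t := by
  intro i j
  have hev : ∀ᶠ x in 𝓝 t, S.hM x (frame E t i x) (frame E t j x) =
      S.formC t (Module.finBasis ℂ E i) (Module.finBasis ℂ E j) (chartAt E t x) := by
    filter_upwards [(chartAt E t).open_source.mem_nhds (mem_chart_source E t),
      eventually_mem_baseSet (F := F) (V := K) (t := t)] with x hxc hx
    exact hM_eq_formC hS hxc hx _ _
  have h1 := contDiffAt_formC hS t (Module.finBasis ℂ E i) (Module.finBasis ℂ E j)
  refine contMDiffAt_real_iff.mpr ⟨?_, ?_⟩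
  · have h2 := h1.continuousAt.comp ((chartAt E t).continuousAt (mem_chart_source E t))
    exact h2.congr (hev.mono fun _ hx => hx.symm)
  · refine h1.congr_of_eventuallyEq ?_
    filter_upwards [eventually_chart hev,
      (chartAt E t).open_target.mem_nhds (mem_chart_target E t)] with y hy hyt
    rw [Function.comp_apply, hy, (chartAt E t).right_inv hyt]

end CVStructure

end CVForms

/-! ### The curvature of the CV-metric -/

section CVCurvature

variable {E : Type*} [NormedAddCommGroup E] [NormedSpace ℂ E] [FiniteDimensional ℂ E]
  {M : Type*} [TopologicalSpace M] [ChartedSpace E M] [IsManifold 𝓘(ℂ, E) ω M]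
  {F : Type*} [NormedAddCommGroup F] [NormedSpace ℂ F] [FiniteDimensional ℂ F]
  {K : M → Type*} [TopologicalSpace (TotalSpace F K)]
  [∀ x, AddCommGroup (K x)] [∀ x, Module ℂ (K x)] [∀ x, TopologicalSpace (K x)]
  [FiberBundle F K] [VectorBundle ℂ F K] [ContMDiffVectorBundle ω F K 𝓘(ℂ, E)]
  {S : CVStructure E F K}

namespace CVStructure

variable (S) in
/-- The covariant derivative `D_X (C_Z)` at `t`, where `Z` is constant in the chart at `t`. -/
noncomputable def derivC (t : M) (X Z : TangentSpace 𝓘(ℂ, E) t) : Module.End ℂ (K t) :=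
  Matrix.toLin (frameBasis F t (FiberBundle.mem_baseSet_trivializationAt' t))
    (frameBasis F t (FiberBundle.mem_baseSet_trivializationAt' t))
    (endDeriv (gramChart (F := F) S.h t) (fun y => (gramChart S.h t y)⁻¹)
      (S.matC t (toModel t Z)) (toModel t X) (chartAt E t t))

/-- The `tt*`-equation in a frame. -/
theorem wirtingerBar_chernForm (hS : S.IsPositive) (t : M) (X : TangentSpace 𝓘(ℂ, E) t) :
    wirtinger Complex.I (toModel t X) (chernForm (F := F) S.h t (toModel t X)) (chartAt E t t) =
      LinearMap.toMatrix (frameBasis F t (FiberBundle.mem_baseSet_trivializationAt' t))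
        (frameBasis F t (FiberBundle.mem_baseSet_trivializationAt' t)) (S.commC t X) := by
  set B := frameBasis F t (FiberBundle.mem_baseSet_trivializationAt' (F := F) (E := K) t) with hB
  refine (Matrix.toLin B B).injective (LinearMap.ext fun a => B.equivFun.injective ?_)
  have h1 := frameCoord_chernCurvature hS (S.isC2Metric_h t) X X a
  have h2 : chernCurvature F S.h X X a = -S.commC t X a :=
    eq_neg_of_add_eq_zero_left (S.tt_star t X X a)
  rw [h2, ← frameBasis_equivFun (FiberBundle.mem_baseSet_trivializationAt' t), map_neg, neg_inj,
    ← frameBasis_equivFun (FiberBundle.mem_baseSet_trivializationAt' t)] at h1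
  rw [Matrix.toLin_toMatrix, h1]
  ext i
  simp [Module.Basis.equivFun_apply, Matrix.repr_toLin, hB]

theorem toMatrix_C_self (t : M) (Z : TangentSpace 𝓘(ℂ, E) t) :
    LinearMap.toMatrix (frameBasis F t (FiberBundle.mem_baseSet_trivializationAt' t))
        (frameBasis F t (FiberBundle.mem_baseSet_trivializationAt' t)) (S.C t Z) =
      S.matC t (toModel t Z) (chartAt E t t) := by
  rw [matC_chartAt (mem_chart_source E t) (FiberBundle.mem_baseSet_trivializationAt' t),
    tangent_symm_toModel]

theorem hM_localExt_eventually (hS : S.IsPositive) {t : M} (Z W : TangentSpace 𝓘(ℂ, E) t) :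
    (fun x => S.hM x (localExt E Z x) (localExt E W x)) ∘ (chartAt E t).symm
      =ᶠ[𝓝 (chartAt E t t)] S.formC t (toModel t Z) (toModel t W) := by
  filter_upwards [eventually_chart (eventually_mem_baseSet (F := F) (V := K) (t := t)),
    (chartAt E t).open_target.mem_nhds (mem_chart_target E t)] with y hy hyt
  rw [Function.comp_apply, tangent_localExt, tangent_localExt,
    hM_eq_formC hS ((chartAt E t).map_target hyt) hy, (chartAt E t).right_inv hyt]

theorem traceCLM_comm (A B : Matrix (Fin (Module.finrank ℂ F)) (Fin (Module.finrank ℂ F)) ℂ) :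
    traceCLM F (A * B) = traceCLM F (B * A) := Matrix.trace_mul_comm A B

/-- The Chern connection of `h^M` is the orthogonal projection of the connection on `End K`. -/
theorem hM_chernD (hS : S.IsPositive) {ζ : ∀ x, K x} (hζ : S.IsPrimitive ζ) {t : M}
    (X Z W : TangentSpace 𝓘(ℂ, E) t) :
    S.hM t (chernD E S.hM (localExt E Z) t X) W = S.hEnd t (S.derivC t X Z) (S.C t W) := by
  have hb := FiberBundle.mem_baseSet_trivializationAt' (F := F) (E := K) t
  have hN := isMetricNear_h hS t
  have h1 := metric_chernD (hM_isPosDef hS hζ) (isC2Metric_hM hS t) Z X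
    (s' := localExt E W) (isHolAt_symm (mem_chart_source E t) _)
  have hev := hM_localExt_eventually hS Z W
  have hd : DifferentiableAt ℝ (S.formC t (toModel t Z) (toModel t W)) (chartAt E t t) :=
    (contDiffAt_formC hS t _ _).differentiableAt (by simp)
  rw [localExt_self] at h1
  have h2 : del (fun x => S.hM x (localExt E Z x) (localExt E W x)) t X =
      wirtinger (-Complex.I) (toModel t X) (S.formC t (toModel t Z) (toModel t W))
        (chartAt E t t) := by
    have h3 := del_symm (mem_chart_source E t) (hd.congr_of_eventuallyEq hev) (toModel t X)
    rwa [tangent_symm_toModel, wirtinger_congr _ _ hev] at h3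
  rw [h1, h2]
  have h4 := hN.wirtinger_trace (traceCLM F) traceCLM_comm
    ((S.contDiffAt_matC t (toModel t Z)).differentiableAt (by simp))
    ((S.contDiffAt_matC t (toModel t W)).differentiableAt (by simp)) (toModel t X)
  refine h4.trans ?_
  rw [hEnd_eq_trace hS hb, derivC, LinearMap.toMatrix_toLin, toMatrix_C_self,
    ← gramChart_chartAt _ (mem_chart_source E t) hb]
  rfl

/-- The Gauss equation for the subbundle `{C_X}` of `End K`, in which the curvature of `End K` has
been replaced by means of the `tt*`-equation. -/
theorem hM_chernCurvature (hS : S.IsPositive) {ζ : ∀ x, K x} (hζ : S.IsPrimitive ζ) {t : M}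
    (X : TangentSpace 𝓘(ℂ, E) t) :
    S.hM t (chernCurvature E S.hM X X X) X =
      -(S.hEnd t (S.commC t X) (S.commC t X) +
        S.hEnd t (S.derivC t X X - S.C t (chernD E S.hM (localExt E X) t X))
          (S.derivC t X X - S.C t (chernD E S.hM (localExt E X) t X))) := by
  have hb := FiberBundle.mem_baseSet_trivializationAt' (F := F) (E := K) t
  have hN := isMetricNear_h hS t
  have hE := hEnd_isPosDef hS t
  have hev := hM_localExt_eventually hS X X
  have hev' : wirtinger (-Complex.I) (toModel t X)
      ((fun x => S.hM x (localExt E X x) (localExt E X x)) ∘ (chartAt E t).symm)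
      =ᶠ[𝓝 (chartAt E t t)]
        wirtinger (-Complex.I) (toModel t X) (S.formC t (toModel t X) (toModel t X)) := by
    filter_upwards [hev.eventually_nhds] with y hy using wirtinger_congr _ _ hy
  have h1 := hN.wirtingerBar_wirtinger_trace (traceCLM F) traceCLM_comm
    (S.contDiffAt_matC t (toModel t X)) (toModel t X)
  have h2 : wirtinger Complex.I (toModel t X)
      (wirtinger (-Complex.I) (toModel t X) (S.formC t (toModel t X) (toModel t X)))
      (chartAt E t t) =
      S.hEnd t (S.commC t X * S.C t X - S.C t X * S.commC t X) (S.C t X) +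
        S.hEnd t (S.derivC t X X) (S.derivC t X X) := by
    refine h1.trans ?_
    have h3 := wirtingerBar_chernForm hS t X
    unfold chernForm at h3
    rw [h3, hEnd_eq_trace hS hb, hEnd_eq_trace hS hb, derivC, LinearMap.toMatrix_toLin, map_sub,
      LinearMap.toMatrix_mul, LinearMap.toMatrix_mul, toMatrix_C_self,
      ← gramChart_chartAt _ (mem_chart_source E t) hb]
    rfl
  rw [metric_chernCurvature_self (hM_isPosDef hS hζ) (isC2Metric_hM hS t),
    wirtinger_congr _ _ hev', h2, hEnd_commC hS]
  set w := chernD E S.hM (localExt E X) t X with hw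
  have h4 := hM_chernD hS hζ X X w
  rw [← hw] at h4
  have h5 : S.hEnd t (S.C t w) (S.derivC t X X) = S.hM t w w := by
    rw [hE.conj_symm, ← h4, ← (hM_isPosDef hS hζ t).conj_symm]
  rw [hE.sub_left, hE.sub_right, hE.sub_right, ← h4, h5, ← hM_eq_hEnd hS]
  ring

/-- If `C_X = -1` then `D_X (C_X)` commutes with all `C_Z`, because `C_X` does so near `t`. -/
theorem commute_derivC (t : M) {X : TangentSpace 𝓘(ℂ, E) t} (hX : S.C t X = -1)
    (Z : TangentSpace 𝓘(ℂ, E) t) : Commute (S.derivC t X X) (S.C t Z) := by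
  have hb := FiberBundle.mem_baseSet_trivializationAt' (F := F) (E := K) t
  have hA := (S.contDiffAt_matC t (toModel t X)).differentiableAt (by simp)
  have hB := (S.contDiffAt_matC t (toModel t Z)).differentiableAt (by simp)
  have hA' := hA.restrictScalars ℝ
  have hB' := hB.restrictScalars ℝ
  have hA1 : S.matC t (toModel t X) (chartAt E t t) = -1 := by
    rw [← toMatrix_C_self, hX, map_neg, LinearMap.toMatrix_one]
  have hev : (fun y => S.matC t (toModel t X) y * S.matC t (toModel t Z) y)
      =ᶠ[𝓝 (chartAt E t t)] fun y => S.matC t (toModel t Z) y * S.matC t (toModel t X) y := by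
    filter_upwards [eventually_chart (eventually_mem_baseSet (F := F) (V := K) (t := t)),
      (chartAt E t).open_target.mem_nhds (mem_chart_target E t)] with y hy hyt
    have h1 := fun W => matC_chartAt (S := S) ((chartAt E t).map_target hyt) hy W
    rw [(chartAt E t).right_inv hyt] at h1
    rw [h1, h1, ← LinearMap.toMatrix_mul, ← LinearMap.toMatrix_mul]
    congr 1
    ext a
    exact S.C_comm _ _ _ a
  have h2 := wirtinger_congr (-Complex.I) (toModel t X) hev
  rw [wirtinger_mul _ _ hA' hB', wirtinger_mul _ _ hB' hA', hA1, neg_one_mul, mul_neg_one,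
    add_comm (-_), add_left_inj] at h2
  have h3 : endDeriv (gramChart (F := F) S.h t) (fun y => (gramChart S.h t y)⁻¹)
      (S.matC t (toModel t X)) (toModel t X) (chartAt E t t) =
      wirtinger (-Complex.I) (toModel t X) (S.matC t (toModel t X)) (chartAt E t t) := by
    rw [endDeriv, hA1]
    simp
  have h4 : S.C t Z = Matrix.toLin (frameBasis F t hb) (frameBasis F t hb)
      (S.matC t (toModel t Z) (chartAt E t t)) := by
    rw [← toMatrix_C_self, Matrix.toLin_toMatrix]
  rw [Commute, SemiconjBy, derivC, h3, h4, Module.End.mul_eq_comp, Module.End.mul_eq_comp,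
    ← Matrix.toLin_mul, ← Matrix.toLin_mul, h2]

/-- An endomorphism that commutes with all `C_Z` is itself of the form `C_W`, since `ζ` is a cyclic
vector. -/
theorem IsPrimitive.exists_eq_C {ζ : ∀ x, K x} (hζ : S.IsPrimitive ζ) {t : M}
    {T : Module.End ℂ (K t)} (hT : ∀ Z, Commute T (S.C t Z)) : ∃ W, T = S.C t W := by
  obtain ⟨W, hW⟩ := (hζ.bij t).2 (-T (ζ t))
  refine ⟨W, LinearMap.ext fun a => ?_⟩
  obtain ⟨Z, hZ⟩ := (hζ.bij t).2 (-a)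
  have hW' : S.C t W (ζ t) = T (ζ t) := neg_inj.mp hW
  have hZ' : S.C t Z (ζ t) = a := neg_inj.mp hZ
  have h1 := LinearMap.congr_fun (hT Z).eq (ζ t)
  rw [Module.End.mul_apply, Module.End.mul_apply] at h1
  rw [← hZ', h1, ← hW', S.C_comm]

theorem IsPrimitive.C_unit {ζ : ∀ x, K x} (hζ : S.IsPrimitive ζ) (t : M) :
    S.C t (hζ.unit t) = -1 := by
  have h1 : -S.C t (hζ.unit t) (ζ t) = ζ t := (hζ.iso t).apply_symm_apply (ζ t)
  refine LinearMap.ext fun a => ?_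
  obtain ⟨Z, hZ⟩ := (hζ.bij t).2 (-a)
  have hZ' : S.C t Z (ζ t) = a := neg_inj.mp hZ
  rw [← hZ', S.C_comm, neg_eq_iff_eq_neg.mp h1, map_neg]
  rfl

theorem IsPrimitive.C_mul {ζ : ∀ x, K x} (hζ : S.IsPrimitive ζ) (t : M)
    (X Y : TangentSpace 𝓘(ℂ, E) t) :
    S.C t (hζ.mul t X Y) = -(S.C t X * S.C t Y) := by
  have h1 : -S.C t (hζ.mul t X Y) (ζ t) = S.C t X (S.C t Y (ζ t)) :=
    (hζ.iso t).apply_symm_apply _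
  refine LinearMap.ext fun a => ?_
  obtain ⟨Z, hZ⟩ := (hζ.bij t).2 (-a)
  have hZ' : S.C t Z (ζ t) = a := neg_inj.mp hZ
  rw [← hZ', S.C_comm, neg_eq_iff_eq_neg.mp h1, map_neg, LinearMap.neg_apply,
    Module.End.mul_apply, S.C_comm t Y Z, S.C_comm t X Z]

/-- Both terms of the Gauss equation vanish for the unit field: `C_e = -1` is central, and
`D_e (C_e)` is tangent to the subbundle `{C_X}` because it commutes with it. -/
theorem sectionalCurvature_unit (hS : S.IsPositive) {ζ : ∀ x, K x} (hζ : S.IsPrimitive ζ) (t : M) :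
    S.sectionalCurvature (hζ.unit t) = 0 := by
  have hE := hEnd_isPosDef hS t
  have hX := hζ.C_unit t
  have hP : S.commC t (hζ.unit t) = 0 := by
    rw [commC, hX]
    simp
  obtain ⟨W, hW⟩ := hζ.exists_eq_C (commute_derivC t hX)
  have hw : chernD E S.hM (localExt E (hζ.unit t)) t (hζ.unit t) = W := by
    refine (hM_isPosDef hS hζ t).ext_left fun Y => ?_
    rw [hM_chernD hS hζ, hW, ← hM_eq_hEnd hS]
  rw [sectionalCurvature, hM_chernCurvature hS hζ, hP, hw, hW, sub_self, hE.zero_left, add_zero,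
    neg_zero, zero_div]

/-- The sectional curvature is bounded above by `-‖[C_X, C_X*]‖² / ‖C_X‖⁴`. -/
theorem sectionalCurvature_le (hS : S.IsPositive) {ζ : ∀ x, K x} (hζ : S.IsPrimitive ζ) {t : M}
    (X : TangentSpace 𝓘(ℂ, E) t) :
    S.sectionalCurvature X ≤
      ((-((S.hEnd t (S.commC t X) (S.commC t X)).re / (S.hM t X X).re ^ 2) : ℝ) : ℂ) := by
  have hE := hEnd_isPosDef hS t
  rw [sectionalCurvature, hM_chernCurvature hS hζ, ← hE.ofReal_re (S.commC t X),
    ← hE.ofReal_re (S.derivC t X X - _), ← (hM_isPosDef hS hζ t).ofReal_re X]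
  have h1 := (Complex.nonneg_iff.mp (hE.nonneg
    (S.derivC t X X - S.C t (chernD E S.hM (localExt E X) t X)))).1
  norm_cast
  rw [neg_div, neg_le_neg_iff]
  exact div_le_div_of_nonneg_right (le_add_of_nonneg_right h1) (sq_nonneg _)

theorem sectionalCurvature_nonpos (hS : S.IsPositive) {ζ : ∀ x, K x} (hζ : S.IsPrimitive ζ) {t : M}
    (X : TangentSpace 𝓘(ℂ, E) t) : S.sectionalCurvature X ≤ 0 := by
  refine (sectionalCurvature_le hS hζ X).trans ?_
  have h1 := (Complex.nonneg_iff.mp ((hEnd_isPosDef hS t).nonneg (S.commC t X))).1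
  norm_cast
  rw [neg_nonpos]
  exact div_nonneg h1 (sq_nonneg _)

end CVStructure

end CVCurvature

/-! ### Irreducible commutative algebras over `ℂ` -/

section IrreducibleAlgebra

variable {W : Type*} [AddCommGroup W] [Module ℂ W]
  {A : Type*} [Ring A] [Algebra ℂ A] {ρ : W →ₗ[ℂ] A} {mul : W → W → W} {e : W}

/-- A faithful commutative representation `ρ` of the algebra `(W, mul)` with unit `e`. -/
structure IsFaithfulRep (ρ : W →ₗ[ℂ] A) (mul : W → W → W) (e : W) : Prop where
  injective : Function.Injective ρ
  map_mul : ∀ X Y, ρ (mul X Y) = ρ X * ρ Y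
  commute : ∀ X Y, Commute (ρ X) (ρ Y)
  map_unit : ρ e = 1

namespace IsFaithfulRep

/-- Multiplication by an element, as a linear map. -/
def mulLeft (hρ : IsFaithfulRep ρ mul e) (Y : W) : W →ₗ[ℂ] W where
  toFun := mul Y
  map_add' a b := hρ.injective (by simp only [hρ.map_mul, map_add, mul_add])
  map_smul' c a := hρ.injective (by simp only [hρ.map_mul, map_smul, mul_smul_comm,
    RingHom.id_apply])

theorem map_mulLeft_pow (hρ : IsFaithfulRep ρ mul e) (Y : W) (n : ℕ) (Z : W) :
    ρ ((hρ.mulLeft Y ^ n) Z) = ρ Y ^ n * ρ Z := by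
  induction n with
  | zero => simp
  | succ n ih =>
    rw [pow_succ', Module.End.mul_apply, pow_succ', mul_assoc, ← ih]
    exact hρ.map_mul _ _

/-- In an irreducible algebra every element is a multiple of the unit plus a nilpotent element:
Fitting's decomposition for multiplication by `X - c e`, where `c` is an eigenvalue of
multiplication by `X`, is a decomposition into ideals. -/
theorem exists_isNilpotent_sub [FiniteDimensional ℂ W] (hρ : IsFaithfulRep ρ mul e)
    (hirr : IsIrreducibleAlgebra mul) (X : W) : ∃ c : ℂ, IsNilpotent (ρ (X - c • e)) := by
  have := hirr.nontrivial
  obtain ⟨c, hc⟩ := Module.End.exists_eigenvalue (hρ.mulLeft X)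
  obtain ⟨v, hv⟩ := hc.exists_hasEigenvector
  refine ⟨c, ?_⟩
  set Y := X - c • e with hY
  have hYv : hρ.mulLeft Y v = 0 := by
    refine hρ.injective ?_
    have h1 : ρ X * ρ v = c • ρ v := by
      rw [← hρ.map_mul, ← map_smul]
      exact congrArg ρ hv.apply_eq_smul
    have h2 : ρ (hρ.mulLeft Y v) = ρ Y * ρ v := hρ.map_mul _ _
    rw [h2, hY, map_sub, map_smul, hρ.map_unit, sub_mul, h1, smul_one_mul, sub_self, map_zero]
  obtain ⟨n, hn1, hn⟩ := ((LinearMap.eventually_isCompl_ker_pow_range_pow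
    (hρ.mulLeft Y)).and (Filter.eventually_ge_atTop 1)).exists
  have hker : IsIdealOf mul (LinearMap.ker (hρ.mulLeft Y ^ n)) := by
    intro a b hb
    rw [LinearMap.mem_ker] at hb ⊢
    refine hρ.injective ?_
    have h1 := congrArg ρ hb
    rw [hρ.map_mulLeft_pow, map_zero] at h1
    rw [hρ.map_mulLeft_pow, hρ.map_mul, ← mul_assoc, ((hρ.commute Y a).pow_left n).eq, mul_assoc,
      h1, mul_zero, map_zero]
  have hrange : IsIdealOf mul (LinearMap.range (hρ.mulLeft Y ^ n)) := by
    rintro a _ ⟨z, rfl⟩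
    refine ⟨mul a z, hρ.injective ?_⟩
    rw [hρ.map_mulLeft_pow, hρ.map_mul, hρ.map_mul, hρ.map_mulLeft_pow, ← mul_assoc,
      ((hρ.commute Y a).pow_left n).eq, mul_assoc]
  rcases hirr.indecomposable _ _ hker hrange hn1 with h0 | h0
  · refine absurd ?_ hv.2
    have h1 : v ∈ LinearMap.ker (hρ.mulLeft Y ^ n) := by
      rw [LinearMap.mem_ker, ← Nat.sub_add_cancel hn, pow_succ, Module.End.mul_apply, hYv, map_zero]
    rw [h0] at h1
    exact (Submodule.mem_bot ℂ).mp h1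
  · refine ⟨n, ?_⟩
    have h1 := hρ.map_mulLeft_pow Y n e
    rw [LinearMap.range_eq_bot.mp h0, LinearMap.zero_apply, map_zero, hρ.map_unit, mul_one] at h1
    exact h1.symm

/-- The nilpotent elements. -/
def nilIdeal (hρ : IsFaithfulRep ρ mul e) : Submodule ℂ W where
  carrier := {X | IsNilpotent (ρ X)}
  add_mem' {X Y} hX hY := by
    simp only [Set.mem_ofPred_eq, map_add] at *
    exact (hρ.commute X Y).isNilpotent_add hX hY
  zero_mem' := by simp
  smul_mem' c X hX := by
    simp only [Set.mem_ofPred_eq, map_smul] at *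
    exact hX.smul c

theorem mem_nilIdeal (hρ : IsFaithfulRep ρ mul e) {X : W} :
    X ∈ hρ.nilIdeal ↔ IsNilpotent (ρ X) := Iff.rfl

theorem nontrivial (hρ : IsFaithfulRep ρ mul e) [Nontrivial W] : Nontrivial A :=
  hρ.injective.nontrivial

theorem le_nilIdeal [FiniteDimensional ℂ W] (hρ : IsFaithfulRep ρ mul e)
    (hirr : IsIrreducibleAlgebra mul) {J : Submodule ℂ W} (hJ : IsIdealOf mul J) (hJ' : J ≠ ⊤) :
    J ≤ hρ.nilIdeal := by
  intro Z hZ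
  obtain ⟨c, hc⟩ := hρ.exists_isNilpotent_sub hirr Z
  by_contra hnil
  have hc0 : c ≠ 0 := by
    rintro rfl
    rw [zero_smul, sub_zero] at hc
    exact hnil hc
  -- otherwise `Z` is invertible, and an ideal containing it is everything
  have hu : IsUnit (ρ Z) := by
    have h1 : ρ Z = c • (1 : A) + ρ (Z - c • e) := by
      rw [map_sub, map_smul, hρ.map_unit, add_sub_cancel]
    have h2 : IsUnit (c • (1 : A)) := by
      rw [← Algebra.algebraMap_eq_smul_one]
      exact (Ne.isUnit hc0).map (algebraMap ℂ A)
    rw [h1]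
    exact hc.isUnit_add_left_of_commute h2 (by
      rw [← Algebra.algebraMap_eq_smul_one]
      exact Algebra.commute_algebraMap_right _ _)
  have hinj : Function.Injective (hρ.mulLeft Z) := by
    refine (injective_iff_map_eq_zero _).mpr fun Y hY => hρ.injective ?_
    have h1 : ρ Z * ρ Y = 0 := by
      rw [← hρ.map_mul, ← map_zero ρ]
      exact congrArg ρ hY
    rw [hu.mul_right_eq_zero.mp h1, map_zero]
  refine hJ' (eq_top_iff.mpr fun X _ => ?_)
  obtain ⟨Y, hY⟩ := LinearMap.injective_iff_surjective.mp hinj X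
  have h2 : mul Y Z = X := by
    rw [← hY]
    refine hρ.injective ?_
    exact (hρ.map_mul _ _).trans ((hρ.commute Y Z).eq.trans (hρ.map_mul _ _).symm)
  rw [← h2]
  exact hJ Y Z hZ

theorem isMaximalIdealOf_nilIdeal [FiniteDimensional ℂ W] (hρ : IsFaithfulRep ρ mul e)
    (hirr : IsIrreducibleAlgebra mul) : IsMaximalIdealOf mul hρ.nilIdeal where
  isIdeal a b hb := by
    rw [mem_nilIdeal] at *
    rw [hρ.map_mul]
    exact (hρ.commute a b).isNilpotent_mul_left hb
  ne_top h0 := by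
    have := hirr.nontrivial
    have := hρ.nontrivial
    have h1 : e ∈ hρ.nilIdeal := h0 ▸ Submodule.mem_top
    rw [mem_nilIdeal, hρ.map_unit] at h1
    exact not_isNilpotent_one h1
  eq_of_le _ hN hle hne := le_antisymm (hρ.le_nilIdeal hirr hN hne) hle

theorem eq_nilIdeal [FiniteDimensional ℂ W] (hρ : IsFaithfulRep ρ mul e)
    (hirr : IsIrreducibleAlgebra mul) {J : Submodule ℂ W} (hJ : IsMaximalIdealOf mul J) :
    J = hρ.nilIdeal :=
  (hJ.eq_of_le _ (hρ.isMaximalIdealOf_nilIdeal hirr).isIdeal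
    (hρ.le_nilIdeal hirr hJ.isIdeal hJ.ne_top)
    (hρ.isMaximalIdealOf_nilIdeal hirr).ne_top).symm

theorem isCompl_nilIdeal [FiniteDimensional ℂ W] (hρ : IsFaithfulRep ρ mul e)
    (hirr : IsIrreducibleAlgebra mul) : IsCompl (Submodule.span ℂ {e}) hρ.nilIdeal := by
  have := hirr.nontrivial
  have := hρ.nontrivial
  refine IsCompl.of_eq ?_ ?_
  · rw [Submodule.eq_bot_iff]
    rintro X ⟨hX, hX'⟩
    obtain ⟨c, rfl⟩ := Submodule.mem_span_singleton.mp hX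
    by_contra hne
    have hc : c ≠ 0 := by
      rintro rfl
      exact hne (zero_smul ℂ e)
    have h1 : IsNilpotent (ρ (c⁻¹ • c • e)) := hρ.nilIdeal.smul_mem c⁻¹ hX'
    rw [inv_smul_smul₀ hc, hρ.map_unit] at h1
    exact not_isNilpotent_one h1
  · refine eq_top_iff.mpr fun X _ => ?_
    obtain ⟨c, hc⟩ := hρ.exists_isNilpotent_sub hirr X
    have h1 := Submodule.add_mem_sup (Submodule.smul_mem _ c (Submodule.mem_span_singleton_self e))
      ((hρ.mem_nilIdeal).mpr hc)
    rwa [add_sub_cancel] at h1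

end IsFaithfulRep

end IrreducibleAlgebra

/-! ### Uniform negativity near an irreducible point -/

section Irreducible

variable {E : Type*} [NormedAddCommGroup E] [NormedSpace ℂ E] [FiniteDimensional ℂ E]
  {M : Type*} [TopologicalSpace M] [ChartedSpace E M] [IsManifold 𝓘(ℂ, E) ω M]
  {F : Type*} [NormedAddCommGroup F] [NormedSpace ℂ F] [FiniteDimensional ℂ F]
  {K : M → Type*} [TopologicalSpace (TotalSpace F K)]
  [∀ x, AddCommGroup (K x)] [∀ x, Module ℂ (K x)] [∀ x, TopologicalSpace (K x)]
  [FiberBundle F K] [VectorBundle ℂ F K] [ContMDiffVectorBundle ω F K 𝓘(ℂ, E)]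
  {S : CVStructure E F K}

instance (t : M) : FiniteDimensional ℂ (TangentSpace 𝓘(ℂ, E) t) :=
  (toModel (M := M) t).symm.finiteDimensional

/-- The identification of the tangent spaces at `t` and at a nearby point through the chart
at `t`. -/
noncomputable def chartTransport (t : M) {x : M} (hx : x ∈ (chartAt E t).source) :
    TangentSpace 𝓘(ℂ, E) t ≃ₗ[ℂ] TangentSpace 𝓘(ℂ, E) x :=
  (toModel t).trans ((trivializationAt E (TangentSpace 𝓘(ℂ, E)) t).linearEquivAt ℂ x hx).symm

theorem chartTransport_apply {t x : M} (hx : x ∈ (chartAt E t).source)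
    (Z : TangentSpace 𝓘(ℂ, E) t) : chartTransport t hx Z = localExt E Z x := by
  rw [tangent_localExt]
  exact (trivializationAt E (TangentSpace 𝓘(ℂ, E)) t).linearEquivAt_symm_apply (R := ℂ) x hx _

namespace CVStructure

/-- The representation `X ↦ -C_X` of the algebra `T_t M`. -/
theorem IsPrimitive.isFaithfulRep {ζ : ∀ x, K x} (hζ : S.IsPrimitive ζ) (t : M) :
    IsFaithfulRep (-S.C t) (hζ.mul t) (hζ.unit t) where
  injective X Y hXY := hζ.C_injective t (neg_inj.mp hXY)
  map_mul X Y := by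
    rw [LinearMap.neg_apply, hζ.C_mul, LinearMap.neg_apply, LinearMap.neg_apply, neg_mul_neg,
      neg_neg]
  commute X Y := LinearMap.ext fun a => by
    simp only [LinearMap.neg_apply, neg_mul_neg]
    exact S.C_comm t X Y a
  map_unit := by rw [LinearMap.neg_apply, hζ.C_unit, neg_neg]

/-- A non-zero nilpotent `C_X` is not normal. -/
theorem commC_ne_zero_of_isNilpotent (hS : S.IsPositive) {ζ : ∀ x, K x} (hζ : S.IsPrimitive ζ)
    {t : M} {X : TangentSpace 𝓘(ℂ, E) t} (hX : IsNilpotent ((-S.C t) X)) (hX0 : X ≠ 0) :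
    S.commC t X ≠ 0 := by
  intro h0
  refine hX0 (hζ.C_injective t ?_)
  rw [LinearMap.neg_apply, isNilpotent_neg_iff] at hX
  rw [map_zero]
  exact (hS t).eq_zero_of_isNilpotent_of_commute (h_C hS t X) (sub_eq_zero.mp h0) hX

theorem commC_smul (t : M) (r : ℝ) (X : TangentSpace 𝓘(ℂ, E) t) :
    S.commC t ((r : ℂ) • X) = ((r ^ 2 : ℝ) : ℂ) • S.commC t X := by
  have h1 : S.adjC t ((r : ℂ) • X) = (r : ℂ) • S.adjC t X := by
    ext a
    simp only [adjC, LinearMap.coe_mk, AddHom.coe_mk, map_smul, LinearMap.smul_apply, map_smulₛₗ,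
      Complex.conj_ofReal]
  rw [commC, h1, map_smul, commC, smul_mul_smul_comm, smul_mul_smul_comm, ← smul_sub]
  push_cast
  rw [sq]

theorem IsPrimitive.adjC_unit {ζ : ∀ x, K x} (hζ : S.IsPrimitive ζ) (t : M) :
    S.adjC t (hζ.unit t) = -1 := by
  ext a
  simp [adjC, hζ.C_unit, S.κ_invol]

theorem IsPrimitive.commC_add_unit {ζ : ∀ x, K x} (hζ : S.IsPrimitive ζ) (t : M) (c : ℂ)
    (X : TangentSpace 𝓘(ℂ, E) t) : S.commC t (X + c • hζ.unit t) = S.commC t X := by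
  have h1 : S.adjC t (X + c • hζ.unit t) = S.adjC t X + conj c • S.adjC t (hζ.unit t) := by
    ext a
    simp [adjC, map_smulₛₗ]
  rw [commC, h1, hζ.adjC_unit, map_add, map_smul, hζ.C_unit, commC]
  simp only [add_mul, mul_add, smul_neg, mul_neg, neg_mul, smul_mul_assoc, mul_smul_comm, one_mul,
    mul_one, smul_smul, smul_add, mul_comm c]
  abel

variable (S) in
/-- The matrix of `[C_Z, C_Z*]` in the frame and the chart at `t`. -/
noncomputable def matComm (t : M) (Z : E) (y : E) :
    Matrix (Fin (Module.finrank ℂ F)) (Fin (Module.finrank ℂ F)) ℂ :=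
  S.matC t Z y * ((gramChart (F := F) S.h t y)⁻¹ * star (S.matC t Z y) * gramChart S.h t y) -
    (gramChart (F := F) S.h t y)⁻¹ * star (S.matC t Z y) * gramChart S.h t y * S.matC t Z y

variable (S) in
/-- The squared norm of `[C_Z, C_Z*]` in the chart at `t`. -/
noncomputable def normComm (t : M) (Z : E) (y : E) : ℂ :=
  Matrix.trace (S.matComm t Z y * (gramChart (F := F) S.h t y)⁻¹ * star (S.matComm t Z y) *
    gramChart S.h t y)

theorem hEnd_commC_eq_normComm (hS : S.IsPositive) {t x : M} (hxc : x ∈ (chartAt E t).source)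
    (hx : x ∈ (trivializationAt F K t).baseSet) (Z : TangentSpace 𝓘(ℂ, E) t) :
    S.hEnd x (S.commC x (localExt E Z x)) (S.commC x (localExt E Z x)) =
      S.normComm t (toModel t Z) (chartAt E t x) := by
  have h1 : LinearMap.toMatrix (frameBasis F t hx) (frameBasis F t hx)
      (S.commC x (localExt E Z x)) = S.matComm t (toModel t Z) (chartAt E t x) := by
    rw [commC, map_sub, LinearMap.toMatrix_mul, LinearMap.toMatrix_mul,
      (hS x).toMatrix_adjoint (frameBasis F t hx) (h_C hS x _), tangent_localExt,
      ← matC_chartAt hxc hx, ← gramChart_chartAt _ hxc hx]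
    rfl
  rw [hEnd_eq_trace hS hx, h1, ← gramChart_chartAt _ hxc hx]
  rfl

/-- Joint continuity in the point and in the tangent vector, in which `C` is linear. -/
theorem continuousAt_matC (t : M) (Z : E) :
    ContinuousAt (fun p : E × E => S.matC t p.2 p.1) (chartAt E t t, Z) := by
  have hb := FiberBundle.mem_baseSet_trivializationAt' (F := F) (E := K) t
  have h1 : ∀ i, ContinuousAt (fun p : E × E =>
      (Module.finBasis ℂ E).equivFun p.2 i • S.matC t (Module.finBasis ℂ E i) p.1)
      (chartAt E t t, Z) := fun i => by
    have h2 : Continuous fun u : E => (Module.finBasis ℂ E).equivFun u i :=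
      (LinearMap.toContinuousLinearMap ((LinearMap.proj i).comp
        (Module.finBasis ℂ E).equivFun.toLinearMap) : E →L[ℂ] ℂ).continuous
    refine ContinuousAt.smul (h2.continuousAt.comp continuousAt_snd) ?_
    have h3 := (S.contDiffAt_matC t (Module.finBasis ℂ E i)).continuousAt
    exact ContinuousAt.comp (f := Prod.fst) (x := (chartAt E t t, Z)) h3 continuousAt_fst
  have h4 : ContinuousAt (fun p : E × E => ∑ i,
      (Module.finBasis ℂ E).equivFun p.2 i • S.matC t (Module.finBasis ℂ E i) p.1)
      (chartAt E t t, Z) := tendsto_finsetSum _ fun i _ => h1 i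
  refine h4.congr ?_
  have h5 : ∀ᶠ p : E × E in 𝓝 (chartAt E t t, Z), p.1 ∈ (chartAt E t).target ∧
      (chartAt E t).symm p.1 ∈ (trivializationAt F K t).baseSet := by
    have h6 : Filter.Tendsto Prod.fst (𝓝 (chartAt E t t, Z)) (𝓝 (chartAt E t t)) :=
      continuous_fst.tendsto _
    refine Filter.Eventually.and (h6.eventually ?_) (h6.eventually (p := fun y : E =>
      (chartAt E t).symm y ∈ (trivializationAt F K t).baseSet) ?_)
    · exact (chartAt E t).open_target.mem_nhds (mem_chart_target E t)
    · exact eventually_chart (eventually_mem_baseSet (F := F) (V := K) (t := t))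
  filter_upwards [h5] with p hp
  have h6 := fun W => matC_chartAt (S := S) ((chartAt E t).map_target hp.1) hp.2 W
  rw [(chartAt E t).right_inv hp.1] at h6
  simp only [h6]
  have h8 : ∀ u : E, (trivializationAt E (TangentSpace 𝓘(ℂ, E)) t).symm
      ((chartAt E t).symm p.1) u = ((trivializationAt E (TangentSpace 𝓘(ℂ, E)) t).linearEquivAt ℂ _
    ((chartAt E t).map_target hp.1)).symm u := fun u => by
    exact ((trivializationAt E (TangentSpace 𝓘(ℂ, E)) t).linearEquivAt_symm_apply (R := ℂ) _
      ((chartAt E t).map_target hp.1) u).symm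
  simp only [h8]
  conv_rhs => rw [← (Module.finBasis ℂ E).sum_equivFun p.2]
  simp only [map_sum, map_smul]

theorem continuousAt_metric (hS : S.IsPositive) (t : M) (Z : E) :
    ContinuousAt (fun p : E × E => gramChart (F := F) S.h t p.1) (chartAt E t t, Z) ∧
      ContinuousAt (fun p : E × E => (gramChart (F := F) S.h t p.1)⁻¹) (chartAt E t t, Z) := by
  have hN := isMetricNear_h hS t
  exact ⟨ContinuousAt.comp (f := Prod.fst) (x := (chartAt E t t, Z)) hN.contDiffAt.continuousAt
    continuousAt_fst, ContinuousAt.comp (f := Prod.fst) (x := (chartAt E t t, Z))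
    hN.contDiffAt_inv.continuousAt continuousAt_fst⟩

theorem continuousAt_formC (hS : S.IsPositive) (t : M) (Z : E) :
    ContinuousAt (fun p : E × E => S.formC t p.2 p.2 p.1) (chartAt E t t, Z) := by
  obtain ⟨h1, h2⟩ := continuousAt_metric hS t Z
  have h3 := continuousAt_matC (S := S) t Z
  exact (traceCLM F).continuous.continuousAt.comp (((h3.mul h2).mul h3.star).mul h1)

theorem continuousAt_normComm (hS : S.IsPositive) (t : M) (Z : E) :
    ContinuousAt (fun p : E × E => S.normComm t p.2 p.1) (chartAt E t t, Z) := by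
  obtain ⟨h1, h2⟩ := continuousAt_metric hS t Z
  have h3 := continuousAt_matC (S := S) t Z
  have h4 : ContinuousAt (fun p : E × E => S.matComm t p.2 p.1) (chartAt E t t, Z) :=
    (h3.mul ((h2.mul h3.star).mul h1)).sub (((h2.mul h3.star).mul h1).mul h3)
  exact (traceCLM F).continuous.continuousAt.comp (((h4.mul h2).mul h4.star).mul h1)

/-- If `[C_Z, C_Z*]` does not vanish at `t` for `0 ≠ Z ∈ N`, then `‖[C_Z, C_Z*]‖²` is bounded below
by a multiple of `‖C_Z‖⁴` near `t`, uniformly for `Z ∈ N` carried along by the chart. Both sides are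
homogeneous of degree four, so this follows from compactness of the unit sphere of `N`. -/
theorem exists_uniform_bound (hS : S.IsPositive) {ζ : ∀ x, K x} (hζ : S.IsPrimitive ζ) {t : M}
    (N : Submodule ℂ (TangentSpace 𝓘(ℂ, E) t)) (hN : ∀ Z ∈ N, Z ≠ 0 → S.commC t Z ≠ 0) :
    ∃ k : ℝ, 0 < k ∧ ∀ᶠ x in 𝓝 t, ∀ Z ∈ N, Z ≠ 0 →
      k * (S.hM x (localExt E Z x) (localExt E Z x)).re ^ 2 <
        (S.hEnd x (S.commC x (localExt E Z x)) (S.commC x (localExt E Z x))).re := by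
  have hb := FiberBundle.mem_baseSet_trivializationAt' (F := F) (E := K) t
  have hpr : ProperSpace E := FiniteDimensional.proper ℂ E
  set T : Set E := Metric.sphere (0 : E) 1 ∩ (N.map (toModel t).toLinearMap : Submodule ℂ E)
    with hT
  have hcomp : IsCompact T :=
    (isCompact_sphere (0 : E) 1).inter_right (Submodule.closed_of_finiteDimensional _)
  set fN : E × E → ℝ := fun p => (S.normComm t p.2 p.1).re with hfN
  set fG : E × E → ℝ := fun p => (S.formC t p.2 p.2 p.1).re with hfG
  have hcN : ∀ Z, ContinuousAt fN (chartAt E t t, Z) := fun Z =>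
    Complex.continuous_re.continuousAt.comp (continuousAt_normComm hS t Z)
  have hcG : ∀ Z, ContinuousAt fG (chartAt E t t, Z) := fun Z =>
    Complex.continuous_re.continuousAt.comp (continuousAt_formC hS t Z)
  have hGx : ∀ {x : M}, x ∈ (chartAt E t).source → x ∈ (trivializationAt F K t).baseSet →
      ∀ Z, (S.hM x (localExt E Z x) (localExt E Z x)).re = fG (chartAt E t x, toModel t Z) := by
    intro x hxc hx Z
    rw [tangent_localExt, hM_eq_formC hS hxc hx]
  have hNx : ∀ {x : M}, x ∈ (chartAt E t).source → x ∈ (trivializationAt F K t).baseSet →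
      ∀ Z, (S.hEnd x (S.commC x (localExt E Z x)) (S.commC x (localExt E Z x))).re =
        fN (chartAt E t x, toModel t Z) := by
    intro x hxc hx Z
    rw [hEnd_commC_eq_normComm hS hxc hx]
  have hmem : ∀ u ∈ T, ∃ Z ∈ N, Z ≠ 0 ∧ toModel t Z = u := by
    rintro u ⟨hu1, Z, hZ, rfl⟩
    refine ⟨Z, hZ, ?_, rfl⟩
    rintro rfl
    simp at hu1
  have hposN : ∀ u ∈ T, 0 < fN (chartAt E t t, u) := by
    intro u hu
    obtain ⟨Z, hZ, hZ0, rfl⟩ := hmem u hu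
    rw [← hNx (mem_chart_source E t) hb, localExt_self]
    exact (Complex.pos_iff.mp ((hEnd_isPosDef hS t).pos _ (hN Z hZ hZ0))).1
  have hposG : ∀ u ∈ T, 0 < fG (chartAt E t t, u) := by
    intro u hu
    obtain ⟨Z, hZ, hZ0, rfl⟩ := hmem u hu
    rw [← hGx (mem_chart_source E t) hb, localExt_self]
    exact (Complex.pos_iff.mp ((hM_isPosDef hS hζ t).pos _ hZ0)).1
  have hpair : Continuous fun u : E => (chartAt E t t, u) := by fun_prop
  have hq : ContinuousOn (fun u => fN (chartAt E t t, u) / fG (chartAt E t t, u) ^ 2) T := by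
    intro u hu
    refine ContinuousAt.continuousWithinAt (ContinuousAt.div ?_ (ContinuousAt.pow ?_ 2)
      (pow_ne_zero 2 (hposG u hu).ne'))
    · exact ContinuousAt.comp (f := fun u : E => (chartAt E t t, u)) (hcN u) hpair.continuousAt
    · exact ContinuousAt.comp (f := fun u : E => (chartAt E t t, u)) (hcG u) hpair.continuousAt
  obtain ⟨m, hm0, hm⟩ := hcomp.exists_forall_le' hq (a := 0) fun u hu =>
    div_pos (hposN u hu) (pow_pos (hposG u hu) 2)
  refine ⟨m / 2, half_pos hm0, ?_⟩
  have hev : ∀ᶠ y in 𝓝 (chartAt E t t), ∀ u ∈ T, m / 2 * fG (y, u) ^ 2 < fN (y, u) := by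
    refine hcomp.eventually_forall_of_forall_eventually fun u hu => ?_
    have h1 : m / 2 * fG (chartAt E t t, u) ^ 2 < fN (chartAt E t t, u) := by
      have h2 := (le_div_iff₀ (pow_pos (hposG u hu) 2)).mp (hm u hu)
      have h3 := mul_pos hm0 (pow_pos (hposG u hu) 2)
      linarith
    exact (continuousAt_const.mul ((hcG u).pow 2)).eventually_lt (hcN u) h1
  filter_upwards [eventually_of_chart hev, eventually_mem_baseSet (F := F) (V := K) (t := t),
    (chartAt E t).open_source.mem_nhds (mem_chart_source E t)] with x hx hxb hxc Z hZ hZ0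
  -- rescale `Z` to the unit sphere
  set u : E := toModel t Z with hu
  have hu0 : u ≠ 0 := (map_ne_zero_iff _ (toModel t).injective).mpr hZ0
  have hn : 0 < ‖u‖ := norm_pos_iff.mpr hu0
  set Y : TangentSpace 𝓘(ℂ, E) t := ((‖u‖⁻¹ : ℝ) : ℂ) • Z with hY
  have hYT : toModel t Y ∈ T := by
    refine ⟨?_, Y, N.smul_mem _ hZ, rfl⟩
    rw [mem_sphere_zero_iff_norm, hY, map_smul, norm_smul, Complex.norm_real, norm_inv, norm_norm,
      ← hu, inv_mul_cancel₀ hn.ne']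
  have hZY : Z = ((‖u‖ : ℝ) : ℂ) • Y := by
    rw [hY, smul_smul, ← Complex.ofReal_mul, mul_inv_cancel₀ hn.ne', Complex.ofReal_one, one_smul]
  have hZY' : localExt E Z x = ((‖u‖ : ℝ) : ℂ) • localExt E Y x := by
    rw [← chartTransport_apply hxc, hZY, map_smul, chartTransport_apply hxc]
  have key := hx _ hYT
  rw [← hGx hxc hxb, ← hNx hxc hxb] at key
  have hE := hEnd_isPosDef hS x
  have hM := hM_isPosDef hS hζ x
  rw [hZY', commC_smul, hE.smul_left, hE.smul_right, hM.smul_left, hM.smul_right,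
    Complex.conj_ofReal, Complex.conj_ofReal, Complex.re_ofReal_mul, Complex.re_ofReal_mul,
    Complex.re_ofReal_mul, Complex.re_ofReal_mul]
  calc m / 2 * (‖u‖ * (‖u‖ * (S.hM x (localExt E Y x) (localExt E Y x)).re)) ^ 2
      = ‖u‖ ^ 4 * (m / 2 * (S.hM x (localExt E Y x) (localExt E Y x)).re ^ 2) := by ring
    _ < ‖u‖ ^ 4 * (S.hEnd x (S.commC x (localExt E Y x)) (S.commC x (localExt E Y x))).re :=
        mul_lt_mul_of_pos_left key (pow_pos hn 4)
    _ = _ := by ring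

/-- A lower bound for `‖[C_X, C_X*]‖²` bounds the sectional curvature from above. -/
theorem sectionalCurvature_lt (hS : S.IsPositive) {ζ : ∀ x, K x} (hζ : S.IsPrimitive ζ) {t : M}
    {X : TangentSpace 𝓘(ℂ, E) t} (hX : X ≠ 0) {k : ℝ}
    (hk : k * (S.hM t X X).re ^ 2 < (S.hEnd t (S.commC t X) (S.commC t X)).re) :
    S.sectionalCurvature X < ((-k : ℝ) : ℂ) := by
  refine (sectionalCurvature_le hS hζ X).trans_lt ?_
  have h1 := (Complex.pos_iff.mp ((hM_isPosDef hS hζ t).pos X hX)).1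
  rw [Complex.real_lt_real, neg_lt_neg_iff]
  exact (lt_div_iff₀ (pow_pos h1 2)).mpr hk

theorem IsPrimitive.unit_ne_zero {ζ : ∀ x, K x} (hζ : S.IsPrimitive ζ) {t : M}
    [Nontrivial (TangentSpace 𝓘(ℂ, E) t)] : hζ.unit t ≠ 0 := by
  have := (hζ.isFaithfulRep t).nontrivial
  intro h0
  have h1 := (hζ.isFaithfulRep t).map_unit
  rw [h0, map_zero] at h1
  exact zero_ne_one h1

/-- If `[C_Z, C_Z*]` does not vanish on the transport to `x` of a complement `N` of `ℂ e_t`, then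
this transport is a complement of `ℂ e_x`: the dimensions add up, and `[C_Z, C_Z*]` vanishes for
`Z` in `ℂ e_x`. -/
theorem isCompl_map_chartTransport {ζ : ∀ x, K x} (hζ : S.IsPrimitive ζ)
    {t x : M} [Nontrivial (TangentSpace 𝓘(ℂ, E) t)]
    {N : Submodule ℂ (TangentSpace 𝓘(ℂ, E) t)} (hN : IsCompl (Submodule.span ℂ {hζ.unit t}) N)
    (hx : x ∈ (chartAt E t).source)
    (hne : ∀ Z ∈ N, Z ≠ 0 → S.commC x (localExt E Z x) ≠ 0) :
    IsCompl (Submodule.span ℂ {hζ.unit x}) (N.map (chartTransport t hx).toLinearMap) := by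
  have : Nontrivial (TangentSpace 𝓘(ℂ, E) x) := (chartTransport t hx).symm.toEquiv.nontrivial
  refine (Submodule.isCompl_iff_disjoint _ _ ?_).mpr ?_
  · rw [finrank_span_singleton hζ.unit_ne_zero,
      LinearEquiv.finrank_map_eq (chartTransport t hx) N,
      ← (chartTransport t hx).finrank_eq, ← Submodule.finrank_add_eq_of_isCompl hN,
      finrank_span_singleton hζ.unit_ne_zero]
  · rw [Submodule.disjoint_def]
    rintro _ hc ⟨Z, hZ, rfl⟩
    obtain ⟨c, hc⟩ := Submodule.mem_span_singleton.mp hc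
    by_contra h0
    have hZ0 : Z ≠ 0 := by
      rintro rfl
      exact h0 (map_zero _)
    refine hne Z hZ hZ0 ?_
    have h1 := hζ.commC_add_unit x c 0
    rw [zero_add, hc] at h1
    have h2 : S.commC x 0 = 0 := by
      rw [commC, map_zero, zero_mul, mul_zero, sub_zero]
    rw [← chartTransport_apply hx, ← h2, ← h1]
    rfl

end CVStructure

end Irreducible

end TTStar

open TTStar

theorem mainTheorem1
    {E : Type*} [NormedAddCommGroup E] [NormedSpace ℂ E] [FiniteDimensional ℂ E]
    {M : Type*} [TopologicalSpace M] [ChartedSpace E M] [IsManifold 𝓘(ℂ, E) ω M]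
    {F : Type*} [NormedAddCommGroup F] [NormedSpace ℂ F] [FiniteDimensional ℂ F]
    {K : M → Type*} [TopologicalSpace (TotalSpace F K)]
    [∀ x, AddCommGroup (K x)] [∀ x, Module ℂ (K x)] [∀ x, TopologicalSpace (K x)]
    [FiberBundle F K] [VectorBundle ℂ F K] [ContMDiffVectorBundle ω F K 𝓘(ℂ, E)]
    (S : TTStar.CVStructure E F K) (hS : S.IsPositive)
    (ζ : ∀ x, K x) (hζ : S.IsPrimitive ζ) :
    -- the three hermitian forms are positive definite
    (∀ t, TTStar.IsPosDefHermitian (S.hEnd t) ∧ TTStar.IsPosDefHermitian (S.hF t) ∧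
      TTStar.IsPosDefHermitian (S.hM t)) ∧
    -- (a)
    (∀ (t : M) (X : TangentSpace 𝓘(ℂ, E) t), X ≠ 0 → S.sectionalCurvature X ≤ 0) ∧
    (∀ t : M, S.sectionalCurvature (hζ.unit t) = 0) ∧
    -- (b)
    (∀ t : M, TTStar.IsIrreducibleAlgebra (hζ.mul t) →
      ∃ Imax : Submodule ℂ (TangentSpace 𝓘(ℂ, E) t),
        -- `Imax` is the maximal ideal and `T_t M = ℂ e ⊕ Imax`
        TTStar.IsMaximalIdealOf (hζ.mul t) Imax ∧
        (∀ J, TTStar.IsMaximalIdealOf (hζ.mul t) J → J = Imax) ∧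
        IsCompl (Submodule.span ℂ {hζ.unit t}) Imax ∧
        ∃ (V : Set M) (U : ∀ x : M, Set (TangentSpace 𝓘(ℂ, E) x)),
          IsOpen V ∧ t ∈ V ∧
          -- the decomposition `T_x M = ℂ e + U x` with `ℂ e ∩ U x = {0}`
          (∀ x ∈ V, (∀ Z : TangentSpace 𝓘(ℂ, E) x, ∃ c : ℂ, ∃ Y ∈ U x, Z = c • hζ.unit x + Y) ∧
            (Submodule.span ℂ {hζ.unit x} : Set (TangentSpace 𝓘(ℂ, E) x)) ∩ U x = {0}) ∧
          -- (i)
          (∀ x ∈ V, ∀ r : ℝ, 0 ≤ r → ∀ Y ∈ U x, (r : ℂ) • Y ∈ U x) ∧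
          (Imax : Set (TangentSpace 𝓘(ℂ, E) t)) ⊆ U t ∧
          -- (ii)
          (∃ k₀ : ℝ, 0 < k₀ ∧ ∀ x ∈ V, ∀ X ∈ U x, X ≠ 0 →
            S.sectionalCurvature X < ((-k₀ : ℝ) : ℂ)) ∧
          -- (iii)
          (∀ lam₀ : ℝ, 0 < lam₀ → ∃ k₁ : ℝ, 0 < k₁ ∧
            ∀ x ∈ V, ∀ X : TangentSpace 𝓘(ℂ, E) x,
              X - hζ.unit x ∈ U x \ {0} →
              (lam₀ : ℂ) * S.hM x X X < S.hM x (X - hζ.unit x) (X - hζ.unit x) →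
              S.sectionalCurvature X < ((-k₁ : ℝ) : ℂ))) := by
  refine ⟨fun t => ⟨CVStructure.hEnd_isPosDef hS t, CVStructure.hF_isPosDef hS t,
    CVStructure.hM_isPosDef hS hζ t⟩, fun t X _ => CVStructure.sectionalCurvature_nonpos hS hζ X,
    fun t => CVStructure.sectionalCurvature_unit hS hζ t, fun t hirr => ?_⟩
  have := hirr.nontrivial
  have hρ := hζ.isFaithfulRep t
  refine ⟨hρ.nilIdeal, hρ.isMaximalIdealOf_nilIdeal hirr, fun J hJ => hρ.eq_nilIdeal hirr hJ,
    hρ.isCompl_nilIdeal hirr, ?_⟩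
  obtain ⟨k, hk0, hk⟩ := CVStructure.exists_uniform_bound hS hζ hρ.nilIdeal
    fun Z hZ hZ0 => CVStructure.commC_ne_zero_of_isNilpotent hS hζ hZ hZ0
  obtain ⟨V, hV, hVo, htV⟩ := mem_nhds_iff.mp
    (hk.and ((chartAt E t).open_source.mem_nhds (mem_chart_source E t)))
  -- the cones are the subspaces obtained from the maximal ideal by transport in the chart
  refine ⟨V, fun x => {X | ∃ Z ∈ hρ.nilIdeal, localExt E Z x = X}, hVo, htV, ?_, ?_, ?_, ?_, ?_⟩
  · intro x hx
    obtain ⟨hkx, hxc⟩ := hV hx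
    have hcompl := CVStructure.isCompl_map_chartTransport hζ (hρ.isCompl_nilIdeal hirr) hxc
      fun Z hZ hZ0 h0 => by
        have h1 := hkx Z hZ hZ0
        rw [h0, (CVStructure.hEnd_isPosDef hS x).zero_left, Complex.zero_re] at h1
        exact absurd h1 (not_lt.mpr (mul_nonneg hk0.le (sq_nonneg _)))
    have hU : {X | ∃ Z ∈ hρ.nilIdeal, localExt E Z x = X} =
        (hρ.nilIdeal.map (chartTransport t hxc).toLinearMap : Set (TangentSpace 𝓘(ℂ, E) x)) := by
      ext X
      exact exists_congr fun Z => and_congr_right fun _ => by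
        rw [← chartTransport_apply hxc]
        rfl
    refine ⟨fun Z => ?_, ?_⟩
    · have h1 : Z ∈ Submodule.span ℂ {hζ.unit x} ⊔
          hρ.nilIdeal.map (chartTransport t hxc).toLinearMap := by
        rw [hcompl.sup_eq_top]
        exact Submodule.mem_top
      obtain ⟨a, ha, Y, hY, rfl⟩ := Submodule.mem_sup.mp h1
      obtain ⟨c, rfl⟩ := Submodule.mem_span_singleton.mp ha
      refine ⟨c, Y, ?_, rfl⟩
      change Y ∈ {X | ∃ Z ∈ hρ.nilIdeal, localExt E Z x = X}
      rw [hU]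
      exact hY
    · change _ ∩ {X | ∃ Z ∈ hρ.nilIdeal, localExt E Z x = X} = _
      rw [hU, ← Submodule.coe_inf, hcompl.inf_eq_bot, Submodule.bot_coe]
  · rintro x hx r _ _ ⟨Z, hZ, rfl⟩
    refine ⟨(r : ℂ) • Z, hρ.nilIdeal.smul_mem _ hZ, ?_⟩
    rw [← chartTransport_apply (hV hx).2, map_smul, chartTransport_apply]
  · exact fun Z hZ => ⟨Z, hZ, localExt_self Z⟩
  · refine ⟨k, hk0, ?_⟩
    rintro x hx _ ⟨Z, hZ, rfl⟩ hX0
    refine CVStructure.sectionalCurvature_lt hS hζ hX0 ((hV hx).1 Z hZ ?_)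
    rintro rfl
    rw [← chartTransport_apply (hV hx).2, map_zero] at hX0
    exact hX0 rfl
  · intro lam₀ hlam
    -- `[C_X, C_X*]` is that of `X - e`, and `h^M(X - e, X - e) > lam₀ h^M(X, X)` enters squared
    refine ⟨k * lam₀ ^ 2, mul_pos hk0 (pow_pos hlam 2), ?_⟩
    rintro x hx X ⟨⟨Z, hZ, hZX⟩, hne⟩ hlt
    have hM := CVStructure.hM_isPosDef hS hζ x
    have hZ0 : Z ≠ 0 := by
      rintro rfl
      rw [← chartTransport_apply (hV hx).2, map_zero] at hZX
      exact hne hZX.symm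
    have h1 := (hV hx).1 Z hZ hZ0
    have h2 : S.commC x X = S.commC x (X - hζ.unit x) := by
      have h3 := hζ.commC_add_unit x 1 (X - hζ.unit x)
      rwa [one_smul, sub_add_cancel] at h3
    rw [hZX, ← h2] at h1
    have hX0 : X ≠ 0 := by
      rintro rfl
      have h4 : S.commC x 0 = 0 := by
        rw [CVStructure.commC, map_zero, zero_mul, mul_zero, sub_zero]
      rw [h4, (CVStructure.hEnd_isPosDef hS x).zero_left, Complex.zero_re] at h1
      exact absurd h1 (not_lt.mpr (mul_nonneg hk0.le (sq_nonneg _)))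
    refine CVStructure.sectionalCurvature_lt hS hζ hX0 (lt_of_le_of_lt ?_ h1)
    have h5 := (Complex.lt_def.mp hlt).1
    rw [Complex.re_ofReal_mul] at h5
    have h6 := (Complex.nonneg_iff.mp (hM.nonneg X)).1
    have h7 := pow_le_pow_left₀ (mul_nonneg hlam.le h6) h5.le 2
    rw [mul_assoc, ← mul_pow]
    exact mul_le_mul_of_nonneg_left h7 hk0.le
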